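/- Let $\mathbb R^4$ carry its standard Euclidean metric and let $\kappa>0$. A homogeneous cubic polynomial $P$ on $\mathbb R^4$ is said to solve the system with constant $\kappa$ if $$\Delta P=0,\qquad |\mathrm{Hess}\,P|^2=\sum_{i,j}(\partial_i\partial_jP)^2=\kappa|x|^2 .$$ $P$ is orthogonally decomposable if $\mathbb R^4=V\oplus W$ with $V,W$ nonzero orthogonal subspaces and $P(v+w)=P(v)+P(w)$ for all $v\in V$, $w\in W$; otherwise it is orthogonally indecomposable. Two polynomials are $O(4)$-equivalent if they lie in one orbit of the action $(g\cdot P)(x)=P(g^{-1}x)$ of $O(4)$. A critical line of $P$ is a line spanned by a nonzero vector $v$ such that $\langle v,\cdot\rangle\wedge dP(v)=0$. Let $$S_\kappa(x)=\tfrac{\sqrt{3\kappa}}{12}\left(x_4^3-x_4(x_1^2+x_2^2+x_3^2)+2\sqrt5\,x_1x_2x_3\right).$$ (1) A homogeneous cubic polynomial $P$ on $\mathbb R^4$ is orthogonally indecomposable and solves the system with constant $\kappa$ if and only if it is $O(4)$-equivalent to $S_\kappa$. (In particular $S_\kappa$ is itself orthogonally indecomposable.) (2) For every such $P$, the automorphism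 group $\{g\in GL(4,\mathbb R): g\cdot P=P\}$ consists of orthogonal transformations and is isomorphic to the symmetric group $S_5$. (3) $S_\kappa$ has exactly $15$ critical lines, namely those spanned by $(0,0,0,1)$; by $(\epsilon_1\sqrt5,\epsilon_2\sqrt5,\epsilon_3\sqrt5,-1)$ and $(\epsilon_1\sqrt5,\epsilon_2\sqrt5,\epsilon_3\sqrt5,3)$ with $\epsilon_i\in\{1,-1\}$, $\epsilon_1\epsilon_2\epsilon_3=1$; and by $(\pm\sqrt5,0,0,1)$, $(0,\pm\sqrt5,0,1)$, $(0,0,\pm\sqrt5,1)$. No two of these lines are orthogonal. -/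

import Mathlib

noncomputable section

/-- The Laplacian of a polynomial on Euclidean `ℝⁿ`. -/
def polyLaplacian {n : ℕ} (P : MvPolynomial (Fin n) ℝ) : MvPolynomial (Fin n) ℝ :=
  ∑ i, MvPolynomial.pderiv i (MvPolynomial.pderiv i P)

/-- The squared norm `|Hess P|² = ∑ᵢⱼ (∂ᵢ∂ⱼP)²` of the Hessian of a polynomial on `ℝⁿ`. -/
def polyHessNormSq {n : ℕ} (P : MvPolynomial (Fin n) ℝ) : MvPolynomial (Fin n) ℝ :=
  ∑ i, ∑ j, (MvPolynomial.pderiv i (MvPolynomial.pderiv j P)) ^ 2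

/-- `P` solves the system `ΔP = 0`, `|Hess P|² = κ |x|²`. -/
structure SolvesSystem {n : ℕ} (κ : ℝ) (P : MvPolynomial (Fin n) ℝ) : Prop where
  harmonic : polyLaplacian P = 0
  hess_sq : polyHessNormSq P =
    MvPolynomial.C κ * ∑ i, (MvPolynomial.X i : MvPolynomial (Fin n) ℝ) ^ 2

/-- The function on Euclidean `ℝⁿ` defined by a polynomial. -/
def polyFun {n : ℕ} (P : MvPolynomial (Fin n) ℝ) (x : EuclideanSpace ℝ (Fin n)) : ℝ :=
  MvPolynomial.eval (fun i => x i) P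

/-- The left action `(g · F)(x) = F(g⁻¹x)` of `GL(n, ℝ)` on functions on `ℝⁿ`. -/
def linAct {n : ℕ} (g : EuclideanSpace ℝ (Fin n) ≃ₗ[ℝ] EuclideanSpace ℝ (Fin n))
    (F : EuclideanSpace ℝ (Fin n) → ℝ) : EuclideanSpace ℝ (Fin n) → ℝ :=
  fun x => F (g⁻¹ x)

/-- `P` and `Q` lie in the same `O(n)`-orbit. -/
def OrthogonallyEquivalent {n : ℕ} (P Q : MvPolynomial (Fin n) ℝ) : Prop :=
  ∃ g : EuclideanSpace ℝ (Fin n) ≃ₗᵢ[ℝ] EuclideanSpace ℝ (Fin n),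
    polyFun P = linAct g.toLinearEquiv (polyFun Q)

/-- `P` decomposes along a direct sum of two nonzero orthogonal subspaces. -/
def OrthogonallyDecomposable {n : ℕ} (P : MvPolynomial (Fin n) ℝ) : Prop :=
  ∃ V W : Submodule ℝ (EuclideanSpace ℝ (Fin n)),
    V ≠ ⊥ ∧ W ≠ ⊥ ∧ IsCompl V W ∧ V.IsOrtho W ∧
      ∀ v ∈ V, ∀ w ∈ W, polyFun P (v + w) = polyFun P v + polyFun P w

/-- The automorphism group of `P`: its stabilizer in the full linear group `GL(n, ℝ)`. -/
def polyAut {n : ℕ} (P : MvPolynomial (Fin n) ℝ) :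
    Subgroup (EuclideanSpace ℝ (Fin n) ≃ₗ[ℝ] EuclideanSpace ℝ (Fin n)) where
  carrier := {g | linAct g (polyFun P) = polyFun P}
  one_mem' := rfl
  mul_mem' := by
    intro a b ha hb
    funext x
    have h1 := congrFun ha x
    have h2 := congrFun hb (a⁻¹ x)
    simp only [linAct] at h1 h2 ⊢
    rw [mul_inv_rev, LinearEquiv.mul_apply, h2, h1]
  inv_mem' := by
    intro a ha
    funext x
    have h1 := congrFun ha (a x)
    have h3 : a⁻¹ (a x) = x := a.symm_apply_apply x
    simp only [linAct, h3] at h1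
    simp only [linAct, inv_inv]
    exact h1.symm

/-- `v` satisfies `⟨v, ·⟩ ∧ dP(v) = 0`. -/
def IsCriticalVector {n : ℕ} (P : MvPolynomial (Fin n) ℝ)
    (v : EuclideanSpace ℝ (Fin n)) : Prop :=
  ∀ i j, v i * polyFun (MvPolynomial.pderiv j P) v = v j * polyFun (MvPolynomial.pderiv i P) v

/-- The critical lines of `P`: the one-dimensional subspaces spanned by a nonzero `v` such that
`⟨v, ·⟩ ∧ dP(v) = 0`. -/
def criticalLines {n : ℕ} (P : MvPolynomial (Fin n) ℝ) :
    Set (Submodule ℝ (EuclideanSpace ℝ (Fin n))) :=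
  {ℓ | ∃ v : EuclideanSpace ℝ (Fin n), v ≠ 0 ∧ IsCriticalVector P v ∧ ℓ = Submodule.span ℝ {v}}

/-- The simplicial cubic form
`(√(3κ)/12) (x₄³ - x₄(x₁² + x₂² + x₃²) + 2√5 x₁x₂x₃)` on `ℝ⁴`
(the coordinates `x₁, x₂, x₃, x₄` have the indices `0, 1, 2, 3`). -/
def simplicialForm (κ : ℝ) : MvPolynomial (Fin 4) ℝ :=
  MvPolynomial.C (Real.sqrt (3 * κ) / 12) *
    (MvPolynomial.X 3 ^ 3
      - MvPolynomial.X 3 * (MvPolynomial.X 0 ^ 2 + MvPolynomial.X 1 ^ 2 + MvPolynomial.X 2 ^ 2)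
      + MvPolynomial.C (2 * Real.sqrt 5) *
        (MvPolynomial.X 0 * MvPolynomial.X 1 * MvPolynomial.X 2))

/-- Generators of the fifteen critical lines of the simplicial form. -/
def simplicialGenerator : Fin 15 → EuclideanSpace ℝ (Fin 4) :=
  ![!₂[0, 0, 0, 1],
    !₂[√5, -√5, -√5, -1], !₂[-√5, √5, -√5, -1], !₂[-√5, -√5, √5, -1], !₂[√5, √5, √5, -1],
    !₂[√5, -√5, -√5, 3], !₂[-√5, √5, -√5, 3], !₂[-√5, -√5, √5, 3], !₂[√5, √5, √5, 3],
    !₂[√5, 0, 0, 1], !₂[-√5, 0, 0, 1],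
    !₂[0, √5, 0, 1], !₂[0, -√5, 0, 1],
    !₂[0, 0, √5, 1], !₂[0, 0, -√5, 1]]

end

/-
Write `P x = T x x x / 6` with `T` symmetric trilinear; the system says that the Hessians `T x` are
trace-free and that `x ↦ T x` is a homothety. At a maximum point `e` of `P` on the unit sphere,
diagonalize `T e` on `eᗮ`, which has dimension three: comparing the equations of the system in this
basis forces `P` to be decomposable unless `T e` is scalar on `eᗮ`. In the scalar case the
restriction of `P` to `eᗮ` again solves the system, with a smaller constant, and in dimension at
most three the scalar case always occurs, so that `P` is determined by `κ` up to isometry.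

The resulting polynomial is a multiple of `∑ i, ⟪w i, x⟫ ^ 3` for the vertices `w i` of a regular
simplex with centre `0`. An automorphism preserves the pairs `x, y` for which `⟪w i, x⟫ * ⟪w i, y⟫`
does not depend on `i`, hence permutes the linear forms `⟪w i, ·⟫` up to a common factor `t` with
`t³ = 1`. A vector is critical exactly when the numbers `⟪w i, v⟫` are roots of one monic quadratic
polynomial, that is, when they take at most two values; the critical lines therefore correspond to
the partitions of the five vertices into two nonempty parts.
-/

section TrilinearForms

/-- Trilinear forms on a real vector space; a cubic form is the restriction of a symmetric one to
the diagonal. -/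
abbrev TrilinForm (E : Type*) [AddCommGroup E] [Module ℝ E] := E →ₗ[ℝ] E →ₗ[ℝ] E →ₗ[ℝ] ℝ

namespace TrilinForm

variable {E F : Type*} [AddCommGroup E] [Module ℝ E] [AddCommGroup F] [Module ℝ F]

/-- Invariance of a trilinear form under all permutations of its arguments. -/
structure IsSymm (T : TrilinForm E) : Prop where
  swap_left : ∀ x y z, T x y z = T y x z
  swap_right : ∀ x y z, T x y z = T x z y

/-- The trilinear form `(x, y, z) ↦ T (f x) (f y) (f z)`. -/
def pullback (T : TrilinForm F) (f : E →ₗ[ℝ] F) : TrilinForm E :=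
  (T.compl₁₂ f f).compr₂ (LinearMap.lcomp ℝ ℝ f)

@[simp]
theorem pullback_apply (T : TrilinForm F) (f : E →ₗ[ℝ] F) (x y z : E) :
    T.pullback f x y z = T (f x) (f y) (f z) := rfl

theorem pullback_smul (c : ℝ) (T : TrilinForm F) (f : E →ₗ[ℝ] F) :
    (c • T).pullback f = c • T.pullback f := rfl

theorem IsSymm.pullback {T : TrilinForm F} (hT : T.IsSymm) (f : E →ₗ[ℝ] F) :
    (T.pullback f).IsSymm :=
  ⟨fun _ _ _ => hT.swap_left _ _ _, fun _ _ _ => hT.swap_right _ _ _⟩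

theorem IsSymm.smul {T : TrilinForm E} (hT : T.IsSymm) (c : ℝ) : (c • T).IsSymm :=
  ⟨fun x y z => congrArg (c * ·) (hT.swap_left x y z),
    fun x y z => congrArg (c * ·) (hT.swap_right x y z)⟩

theorem IsSymm.apply_add_self {T : TrilinForm E} (hT : T.IsSymm) (x y : E) :
    T (x + y) (x + y) (x + y) = T x x x + 3 * T x x y + 3 * T x y y + T y y y := by
  simp only [map_add, LinearMap.add_apply, hT.swap_left y x, hT.swap_right _ y x]
  ring

theorem IsSymm.six_mul_apply {T : TrilinForm E} (hT : T.IsSymm) (x y z : E) :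
    6 * T x y z = T (x + y + z) (x + y + z) (x + y + z) - T (x + y) (x + y) (x + y)
      - T (x + z) (x + z) (x + z) - T (y + z) (y + z) (y + z)
      + T x x x + T y y y + T z z z := by
  simp only [map_add, LinearMap.add_apply, hT.swap_left y x, hT.swap_left z x, hT.swap_left z y,
    hT.swap_right _ y x, hT.swap_right _ z x, hT.swap_right _ z y]
  ring

theorem IsSymm.ext_diag {S T : TrilinForm E} (hS : S.IsSymm) (hT : T.IsSymm)
    (h : ∀ x, S x x x = T x x x) : S = T := by
  ext x y z
  have hx := hS.six_mul_apply x y z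
  simp only [h, ← hT.six_mul_apply] at hx
  linarith

end TrilinForm

end TrilinearForms

section OrthonormalBases

open Module (finrank)
open scoped RealInnerProductSpace TensorProduct

variable {E : Type*} [NormedAddCommGroup E] [InnerProductSpace ℝ E]

theorem sum_apply_orthonormalBasis_eq [FiniteDimensional ℝ E] {ι κ : Type*} [Fintype ι]
    [Fintype κ] (B : E →ₗ[ℝ] E →ₗ[ℝ] ℝ) (b : OrthonormalBasis ι ℝ E)
    (b' : OrthonormalBasis κ ℝ E) : ∑ i, B (b i) (b i) = ∑ i, B (b' i) (b' i) := by
  have h := (InnerProductSpace.canonicalCovariantTensor_eq_sum E b).symm.trans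
    (InnerProductSpace.canonicalCovariantTensor_eq_sum E b')
  simpa using congrArg (TensorProduct.lift B) h

theorem sum_sum_apply_orthonormalBasis_eq [FiniteDimensional ℝ E] {ι κ : Type*} [Fintype ι]
    [Fintype κ] (A B : E →ₗ[ℝ] E →ₗ[ℝ] ℝ) (b : OrthonormalBasis ι ℝ E)
    (b' : OrthonormalBasis κ ℝ E) :
    ∑ i, ∑ j, A (b i) (b j) * B (b i) (b j) = ∑ i, ∑ j, A (b' i) (b' j) * B (b' i) (b' j) := by
  have right (x : E) : ∑ j, A x (b j) * B x (b j) = ∑ j, A x (b' j) * B x (b' j) :=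
    sum_apply_orthonormalBasis_eq ((LinearMap.mul ℝ ℝ).compl₁₂ (A x) (B x)) b b'
  have left (y : E) : ∑ i, A (b i) y * B (b i) y = ∑ i, A (b' i) y * B (b' i) y :=
    sum_apply_orthonormalBasis_eq ((LinearMap.mul ℝ ℝ).compl₁₂ (A.flip y) (B.flip y)) b b'
  simp only [right]
  rw [Finset.sum_comm, Finset.sum_comm (γ := κ) (α := κ)]
  simp only [left]

theorem exists_orthonormalBasis_cons [FiniteDimensional ℝ E] {n : ℕ} {e : E} (he : ‖e‖ = 1)
    (b : OrthonormalBasis (Fin n) ℝ (ℝ ∙ e)ᗮ) :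
    ∃ b' : OrthonormalBasis (Fin (n + 1)) ℝ E, b' 0 = e ∧ ∀ i : Fin n, b' i.succ = b i := by
  let v : Fin (n + 1) → E := Fin.cons e fun i => b i
  have he_perp (i : Fin n) : ⟪e, (b i : E)⟫ = 0 :=
    Submodule.mem_orthogonal_singleton_iff_inner_right.1 (b i).2
  have hb := orthonormal_iff_ite.1 b.orthonormal
  have hv : Orthonormal ℝ v := by
    rw [orthonormal_iff_ite]
    intro i j
    cases i using Fin.cases <;> cases j using Fin.cases
    · simp [v, he]
    · simp [v, he_perp, (Fin.succ_ne_zero _).symm]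
    · simp [v, real_inner_comm, he_perp]
    · simpa [v] using hb _ _
  have hdim : finrank ℝ E = n + 1 := by
    have h := (ℝ ∙ e).finrank_add_finrank_orthogonal
    rw [finrank_span_singleton (by rintro rfl; simp at he), Module.finrank_eq_card_basis b.toBasis,
      Fintype.card_fin] at h
    lia
  have hspan : ⊤ ≤ Submodule.span ℝ (Set.range v) :=
    (hv.linearIndependent.span_eq_top_of_card_eq_finrank' (by simp [hdim])).ge
  exact ⟨OrthonormalBasis.mk hv hspan, by simp [v], fun i => by simp [v]⟩

theorem exists_orthonormalBasis_isDiag [FiniteDimensional ℝ E] {n : ℕ} (hn : finrank ℝ E = n)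
    (B : E →ₗ[ℝ] E →ₗ[ℝ] ℝ) (hB : ∀ x y, B x y = B y x) :
    ∃ b : OrthonormalBasis (Fin n) ℝ E, ∀ i j, i ≠ j → B (b i) (b j) = 0 := by
  let c := stdOrthonormalBasis ℝ E
  let A : E →ₗ[ℝ] E := ∑ i, (B.flip (c i)).smulRight (c i)
  have hA (x y : E) : ⟪A x, y⟫ = B x y := by
    conv_rhs => rw [← c.sum_repr' y]
    simp [A, sum_inner, inner_smul_left, mul_comm]
  have hsymm : A.IsSymmetric := fun x y => by rw [hA, real_inner_comm, hA, hB]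
  refine ⟨hsymm.eigenvectorBasis hn, fun i j hij => ?_⟩
  rw [← hA, hsymm.apply_eigenvectorBasis, inner_smul_left,
    (hsymm.eigenvectorBasis hn).orthonormal.2 hij, mul_zero]

end OrthonormalBases

section Maximum

open scoped RealInnerProductSpace

variable {E : Type*} [NormedAddCommGroup E] [InnerProductSpace ℝ E]

theorem nonpos_of_forall_pos_cubic_nonpos {a b c d : ℝ}
    (h : ∀ t : ℝ, 0 < t → a + b * t + c * t ^ 2 + d * t ^ 3 ≤ 0) : a ≤ 0 := by
  have hlim : Filter.Tendsto (fun t : ℝ => a + b * t + c * t ^ 2 + d * t ^ 3)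
      (nhdsWithin 0 (Set.Ioi 0)) (nhds (a + b * 0 + c * 0 ^ 2 + d * 0 ^ 3)) :=
    (Continuous.tendsto (by fun_prop) 0).mono_left nhdsWithin_le_nhds
  simpa using le_of_tendsto hlim (Filter.eventually_of_mem self_mem_nhdsWithin h)

theorem eq_zero_and_nonpos_of_forall_quartic_nonpos {a b c d : ℝ}
    (h : ∀ t : ℝ, a * t + b * t ^ 2 + c * t ^ 3 + d * t ^ 4 ≤ 0) : a = 0 ∧ b ≤ 0 := by
  have ha_nonpos : a ≤ 0 := nonpos_of_forall_pos_cubic_nonpos (b := b) (c := c) (d := d)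
    fun t ht => nonpos_of_mul_nonpos_right (by linarith [h t]) ht
  have ha_nonneg : -a ≤ 0 := nonpos_of_forall_pos_cubic_nonpos (b := b) (c := -c) (d := d)
    fun t ht => nonpos_of_mul_nonpos_right (by linarith [h (-t)]) ht
  have ha : a = 0 := by linarith
  subst ha
  exact ⟨rfl, nonpos_of_forall_pos_cubic_nonpos (b := c) (c := d) (d := 0)
    fun t ht => nonpos_of_mul_nonpos_right (by linarith [h t]) (pow_pos ht 2)⟩

theorem TrilinForm.continuous_apply_self [FiniteDimensional ℝ E] (T : TrilinForm E) :
    Continuous fun x => T x x x := by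
  let L := (T.compr₂ LinearMap.toContinuousLinearMap.toLinearMap).toContinuousBilinearMap
  exact ((L.continuous.clm_apply continuous_id).clm_apply continuous_id :
    Continuous fun x => L x x x)

theorem TrilinForm.exists_apply_self_le [FiniteDimensional ℝ E] [Nontrivial E]
    (T : TrilinForm E) :
    ∃ e : E, ‖e‖ = 1 ∧ 0 ≤ T e e e ∧ ∀ x, T x x x ≤ T e e e * ‖x‖ ^ 3 := by
  obtain ⟨e, he, hmax⟩ := (isCompact_sphere (0 : E) 1).exists_isMaxOn
    (NormedSpace.sphere_nonempty.2 zero_le_one) T.continuous_apply_self.continuousOn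
  have hle {x : E} (hx : ‖x‖ = 1) : T x x x ≤ T e e e := hmax (by simpa using hx)
  have he1 : ‖e‖ = 1 := by simpa using he
  have hneg : -T e e e ≤ T e e e := by simpa using hle (x := -e) (by simpa using he1)
  refine ⟨e, he1, by linarith, fun x => ?_⟩
  rcases eq_or_ne x 0 with rfl | hx
  · simp
  have hunit := hle (norm_smul_inv_norm (𝕜 := ℝ) hx)
  simp only [map_smul, LinearMap.smul_apply, smul_eq_mul, RCLike.ofReal_real_eq_id, id] at hunit
  calc T x x x = (‖x‖⁻¹ * (‖x‖⁻¹ * (‖x‖⁻¹ * T x x x))) * ‖x‖ ^ 3 := by field_simp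
    _ ≤ T e e e * ‖x‖ ^ 3 := by gcongr

theorem TrilinForm.IsSymm.critical_of_apply_self_le {T : TrilinForm E} (hT : T.IsSymm) {e v : E}
    (he : ‖e‖ = 1) (hpos : 0 ≤ T e e e) (hmax : ∀ x, T x x x ≤ T e e e * ‖x‖ ^ 3)
    (hv : ⟪e, v⟫ = 0) : T e e v = 0 ∧ 2 * T e v v ≤ T e e e * ‖v‖ ^ 2 := by
  have hbound (t : ℝ) : ‖e + t • v‖ ^ 3 ≤ (1 + t ^ 2 * ‖v‖ ^ 2) * (1 + t ^ 2 * ‖v‖ ^ 2 / 2) := by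
    have hsq : ‖e + t • v‖ ^ 2 = 1 + t ^ 2 * ‖v‖ ^ 2 := by
      rw [norm_add_sq_real, inner_smul_right, hv, he, norm_smul, mul_pow, Real.norm_eq_abs, sq_abs]
      ring
    have hle : ‖e + t • v‖ ≤ 1 + t ^ 2 * ‖v‖ ^ 2 / 2 := by
      nlinarith [sq_nonneg (‖e + t • v‖ - 1)]
    calc ‖e + t • v‖ ^ 3 = ‖e + t • v‖ ^ 2 * ‖e + t • v‖ := by ring
      _ ≤ _ := by rw [hsq]; gcongr
  have hquartic := eq_zero_and_nonpos_of_forall_quartic_nonpos (a := 3 * T e e v)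
    (b := 3 * T e v v - T e e e * (3 / 2 * ‖v‖ ^ 2)) (c := T v v v)
    (d := -(T e e e * (‖v‖ ^ 4 / 2))) fun t => by
      have h := (hmax (e + t • v)).trans (mul_le_mul_of_nonneg_left (hbound t) hpos)
      rw [hT.apply_add_self] at h
      simp only [map_smul, LinearMap.smul_apply, smul_eq_mul] at h
      linarith
  exact ⟨by linarith [hquartic.1], by linarith [hquartic.2]⟩

end Maximum

section HessianSystem

open Module (finrank)
open scoped RealInnerProductSpace

variable {E : Type*} [NormedAddCommGroup E] [InnerProductSpace ℝ E]

namespace TrilinForm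

/-- The system `ΔP = 0`, `|Hess P|² = κ |x|²` for the cubic form `P x = T x x x / 6`, with the
second equation polarized; `T x` is then the Hessian of `P` at `x`. -/
structure SolvesSystem (κ : ℝ) (T : TrilinForm E) : Prop where
  isSymm : T.IsSymm
  trace {n : ℕ} (b : OrthonormalBasis (Fin n) ℝ E) (x : E) : ∑ i, T x (b i) (b i) = 0
  hess {n : ℕ} (b : OrthonormalBasis (Fin n) ℝ E) (x y : E) :
    ∑ i, ∑ j, T x (b i) (b j) * T y (b i) (b j) = κ * ⟪x, y⟫

theorem SolvesSystem.of_orthonormalBasis {κ : ℝ} {T : TrilinForm E} {ι : Type*} [Fintype ι]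
    (b : OrthonormalBasis ι ℝ E) (hT : T.IsSymm) (htrace : ∀ x, ∑ i, T x (b i) (b i) = 0)
    (hhess : ∀ x y, ∑ i, ∑ j, T x (b i) (b j) * T y (b i) (b j) = κ * ⟪x, y⟫) :
    T.SolvesSystem κ :=
  have : FiniteDimensional ℝ E := .of_basis b.toBasis
  { isSymm := hT
    trace := fun b' x => (sum_apply_orthonormalBasis_eq (T x) b' b).trans (htrace x)
    hess := fun b' x y =>
      (sum_sum_apply_orthonormalBasis_eq (T x) (T y) b' b).trans (hhess x y) }

/-- A unit vector `e` together with an orthonormal basis of `eᗮ` satisfying the first and second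
order conditions at a maximum point `e` of the cubic form on the unit sphere, and diagonalizing the
Hessian at `e`. -/
structure IsAdapted {n : ℕ} (T : TrilinForm E) (e : E)
    (b : OrthonormalBasis (Fin n) ℝ (ℝ ∙ e)ᗮ) : Prop where
  norm_eq : ‖e‖ = 1
  nonneg : 0 ≤ T e e e
  apply_perp (i : Fin n) : T e e (b i) = 0
  apply_of_ne {i j : Fin n} (hij : i ≠ j) : T e (b i) (b j) = 0
  two_mul_le (i : Fin n) : 2 * T e (b i) (b i) ≤ T e e e

theorem IsSymm.exists_isAdapted {n : ℕ} {T : TrilinForm E} (hT : T.IsSymm)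
    (hn : finrank ℝ E = n + 1) :
    ∃ (e : E) (b : OrthonormalBasis (Fin n) ℝ (ℝ ∙ e)ᗮ), T.IsAdapted e b := by
  have hfact : Fact (finrank ℝ E = n + 1) := ⟨hn⟩
  have : FiniteDimensional ℝ E := .of_fact_finrank_eq_succ n
  have : Nontrivial E := Module.nontrivial_of_finrank_eq_succ hn
  obtain ⟨e, he, hpos, hmax⟩ := T.exists_apply_self_le
  have hcrit (v : (ℝ ∙ e)ᗮ) :=
    hT.critical_of_apply_self_le he hpos hmax
      (Submodule.mem_orthogonal_singleton_iff_inner_right.1 v.2)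
  have hdim : finrank ℝ (ℝ ∙ e)ᗮ = n :=
    Submodule.finrank_orthogonal_span_singleton (by rintro rfl; simp at he)
  obtain ⟨b, hb⟩ := exists_orthonormalBasis_isDiag hdim
    ((T e).domRestrict₁₂ (ℝ ∙ e)ᗮ (ℝ ∙ e)ᗮ) fun x y => hT.swap_right _ _ _
  refine ⟨e, b, he, hpos, fun i => (hcrit (b i)).1, fun {i j} => hb i j, fun i => ?_⟩
  have hnorm : ‖(b i : E)‖ = 1 := b.orthonormal.1 i
  simpa only [hnorm, one_pow, mul_one] using (hcrit (b i)).2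

section Equations

variable {κ : ℝ} {T : TrilinForm E} {n : ℕ} {e : E} {b : OrthonormalBasis (Fin n) ℝ (ℝ ∙ e)ᗮ}

namespace IsAdapted

theorem sum_apply_mul (hb : T.IsAdapted e b) (i : Fin n) (f : Fin n → ℝ) :
    ∑ j, T e (b i) (b j) * f j = T e (b i) (b i) * f i :=
  Finset.sum_eq_single_of_mem i (Finset.mem_univ i)
    fun j _ hji => by rw [hb.apply_of_ne hji.symm, zero_mul]

theorem apply_eq_zero (hb : T.IsAdapted e b) (v : (ℝ ∙ e)ᗮ) : T e e v = 0 := by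
  rw [← b.sum_repr v]
  simp [hb.apply_perp]

theorem apply_eq_inner (hb : T.IsAdapted e b) {c : ℝ} (hc : ∀ i, T e (b i) (b i) = c)
    (v w : (ℝ ∙ e)ᗮ) : T e v w = c * ⟪v, w⟫ := by
  have hbasis : (T e).domRestrict₁₂ (ℝ ∙ e)ᗮ (ℝ ∙ e)ᗮ = c • innerₗ _ := by
    refine b.toBasis.ext fun i => b.toBasis.ext fun j => ?_
    rcases eq_or_ne i j with rfl | hij
    · simp [LinearMap.domRestrict₁₂_apply, hc]
    · simp [LinearMap.domRestrict₁₂_apply, hb.apply_of_ne hij, b.inner_eq_ite, hij]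
  exact congrArg (fun B => B v w) hbasis

end IsAdapted

variable [FiniteDimensional ℝ E]

theorem SolvesSystem.trace_cons (h : T.SolvesSystem κ) (he : ‖e‖ = 1)
    (b : OrthonormalBasis (Fin n) ℝ (ℝ ∙ e)ᗮ) (x : E) : T x e e + ∑ i, T x (b i) (b i) = 0 := by
  obtain ⟨b', hb'_zero, hb'_succ⟩ := exists_orthonormalBasis_cons he b
  simpa only [Fin.sum_univ_succ, hb'_zero, hb'_succ] using h.trace b' x

theorem SolvesSystem.hess_cons (h : T.SolvesSystem κ) (he : ‖e‖ = 1)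
    (b : OrthonormalBasis (Fin n) ℝ (ℝ ∙ e)ᗮ) (x y : E) :
    T e e x * T e e y + 2 * ∑ j, T e x (b j) * T e y (b j)
      + ∑ i, ∑ j, T x (b i) (b j) * T y (b i) (b j) = κ * ⟪x, y⟫ := by
  obtain ⟨b', hb'_zero, hb'_succ⟩ := exists_orthonormalBasis_cons he b
  have hess := h.hess b' x y
  have swap (z w : E) : T z e w = T e z w ∧ T z w e = T e z w :=
    ⟨h.isSymm.swap_left _ _ _, by rw [h.isSymm.swap_right, h.isSymm.swap_left]⟩
  simp only [Fin.sum_univ_succ, hb'_zero, hb'_succ, Finset.sum_add_distrib, fun z w => (swap z w).1,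
    fun z w => (swap z w).2] at hess
  linarith

namespace IsAdapted

theorem trace_eq_zero (hb : T.IsAdapted e b) (h : T.SolvesSystem κ) :
    T e e e + ∑ i, T e (b i) (b i) = 0 :=
  h.trace_cons hb.norm_eq b e

theorem sum_sq_eq (hb : T.IsAdapted e b) (h : T.SolvesSystem κ) :
    T e e e ^ 2 + ∑ i, T e (b i) (b i) ^ 2 = κ := by
  have hess := h.hess_cons hb.norm_eq b e e
  simp only [hb.apply_perp, hb.sum_apply_mul, real_inner_self_eq_norm_sq, hb.norm_eq, mul_zero,
    Finset.sum_const_zero, add_zero, one_pow, mul_one] at hess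
  simp only [sq, hess]

theorem sum_perp_eq_zero (hb : T.IsAdapted e b) (h : T.SolvesSystem κ) (a : Fin n) :
    ∑ i, T (b a) (b i) (b i) = 0 := by
  have htrace := h.trace_cons hb.norm_eq b (b a)
  rwa [h.isSymm.swap_left, h.isSymm.swap_right, hb.apply_perp, zero_add] at htrace

theorem sum_mul_perp_eq_zero (hb : T.IsAdapted e b) (h : T.SolvesSystem κ) (a : Fin n) :
    ∑ i, T e (b i) (b i) * T (b a) (b i) (b i) = 0 := by
  have hess := h.hess_cons hb.norm_eq b e (b a)
  have hperp : ⟪e, (b a : E)⟫ = 0 := Submodule.mem_orthogonal_singleton_iff_inner_right.1 (b a).2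
  simpa only [hb.apply_perp, hb.sum_apply_mul, hperp, mul_zero, zero_mul, Finset.sum_const_zero,
    zero_add] using hess

theorem sum_sum_perp_eq (hb : T.IsAdapted e b) (h : T.SolvesSystem κ) (a c : Fin n) :
    ∑ i, ∑ j, T (b a) (b i) (b j) * T (b c) (b i) (b j) =
      if a = c then κ - 2 * T e (b a) (b a) ^ 2 else 0 := by
  have hess := h.hess_cons hb.norm_eq b (b a) (b c)
  rw [hb.apply_perp, hb.sum_apply_mul, zero_mul, zero_add, ← Submodule.coe_inner,
    orthonormal_iff_ite.1 b.orthonormal] at hess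
  split_ifs with hac
  · subst hac
    rw [if_pos rfl] at hess
    linarith
  · rw [if_neg hac, hb.apply_of_ne (Ne.symm hac)] at hess
    linarith

theorem pos (hb : T.IsAdapted e b) (h : T.SolvesSystem κ) (hκ : 0 < κ) : 0 < T e e e := by
  refine hb.nonneg.lt_of_ne fun hm => ?_
  have hle (i : Fin n) : T e (b i) (b i) ≤ 0 := by linarith [hb.two_mul_le i]
  have hsum : ∑ i, T e (b i) (b i) = 0 := by linarith [hb.trace_eq_zero h]
  have hzero := (Finset.sum_eq_zero_iff_of_nonpos fun i _ => hle i).1 hsum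
  have hsq := hb.sum_sq_eq h
  rw [← hm, Finset.sum_eq_zero fun i hi => by rw [hzero i hi, sq, zero_mul]] at hsq
  linarith

end IsAdapted

end Equations

end TrilinForm

end HessianSystem

section NormalForm

open Module (finrank)
open scoped RealInnerProductSpace

variable {E : Type*} [NormedAddCommGroup E] [InnerProductSpace ℝ E]

/-- The normal form, in suitable orthonormal coordinates, of six times a cubic form solving the
system with constant `κ` whose Hessian at a maximum point on the unit sphere is scalar on the
orthogonal complement, recursively in that complement. -/
noncomputable def normalForm : (n : ℕ) → ℝ → (Fin n → ℝ) → ℝ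
  | 0, _, _ => 0
  | n + 1, κ, x => √(n * κ / (n + 1)) * (x 0 ^ 3 - 3 / n * (x 0 * ∑ i : Fin n, x i.succ ^ 2))
      + normalForm n (κ * (1 - 2 / (n * (n + 1)))) fun i => x i.succ

namespace TrilinForm

/-- Some orthonormal coordinates put the cubic form `T x x x` into the shape `normalForm n κ`. -/
def HasNormalForm (n : ℕ) (κ : ℝ) (T : TrilinForm E) : Prop :=
  ∃ b : OrthonormalBasis (Fin n) ℝ E, ∀ x, T x x x = normalForm n κ (b.repr x)

theorem HasNormalForm.exists_isometryEquiv {F : Type*} [NormedAddCommGroup F]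
    [InnerProductSpace ℝ F] {n : ℕ} {κ : ℝ} {S : TrilinForm E} {T : TrilinForm F}
    (hS : S.HasNormalForm n κ) (hT : T.HasNormalForm n κ) :
    ∃ g : F ≃ₗᵢ[ℝ] E, ∀ x, S x x x = T (g.symm x) (g.symm x) (g.symm x) := by
  obtain ⟨b, hb⟩ := hS
  obtain ⟨c, hc⟩ := hT
  exact ⟨c.repr.trans b.repr.symm, fun x => by simp [hb, hc]⟩

variable [FiniteDimensional ℝ E] {κ : ℝ} {T : TrilinForm E} {n : ℕ} {e : E}
  {b : OrthonormalBasis (Fin n) ℝ (ℝ ∙ e)ᗮ}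

theorem SolvesSystem.pullback_perp (h : T.SolvesSystem κ) (he : ‖e‖ = 1) {c : ℝ}
    (hlin : ∀ v : (ℝ ∙ e)ᗮ, T e e v = 0) (hscalar : ∀ v w : (ℝ ∙ e)ᗮ, T e v w = c * ⟪v, w⟫) :
    (T.pullback (ℝ ∙ e)ᗮ.subtype).SolvesSystem (κ - 2 * c ^ 2) where
  isSymm := h.isSymm.pullback _
  trace b v := by
    have htrace := h.trace_cons he b v
    rwa [h.isSymm.swap_left, h.isSymm.swap_right, hlin, zero_add] at htrace
  hess b v w := by
    have hess := h.hess_cons he b v w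
    have hsum : ∑ j, T e v (b j) * T e w (b j) = c ^ 2 * ⟪v, w⟫ := by
      rw [← b.sum_inner_mul_inner, Finset.mul_sum]
      refine Finset.sum_congr rfl fun j _ => ?_
      rw [hscalar, hscalar, real_inner_comm w]
      ring
    rw [hlin, hsum, ← Submodule.coe_inner] at hess
    simp only [pullback_apply, Submodule.subtype_apply]
    linarith

theorem HasNormalForm.succ (hT : T.IsSymm) (he : ‖e‖ = 1)
    (hmax : T e e e = √(n * κ / (n + 1))) (hlin : ∀ v : (ℝ ∙ e)ᗮ, T e e v = 0)
    (hscalar : ∀ v w : (ℝ ∙ e)ᗮ, T e v w = -(T e e e / n) * ⟪v, w⟫)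
    (hperp : (T.pullback (ℝ ∙ e)ᗮ.subtype).HasNormalForm n (κ * (1 - 2 / (n * (n + 1))))) :
    T.HasNormalForm (n + 1) κ := by
  obtain ⟨b, hb⟩ := hperp
  obtain ⟨b', hb'_zero, hb'_succ⟩ := exists_orthonormalBasis_cons he b
  refine ⟨b', fun x => ?_⟩
  let v : (ℝ ∙ e)ᗮ := b.repr.symm (WithLp.toLp 2 fun i => b'.repr x i.succ)
  have hv (i : Fin n) : b.repr v i = b'.repr x i.succ := by simp [v]
  have hx : x = b'.repr x 0 • e + v := by
    conv_lhs => rw [← b'.sum_repr x, Fin.sum_univ_succ, hb'_zero]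
    conv_rhs => rw [← b.sum_repr v]
    simp [hv, hb'_succ]
  have hnorm : ⟪v, v⟫ = ∑ i : Fin n, b'.repr x i.succ ^ 2 := by
    rw [real_inner_self_eq_norm_sq, ← b.repr.norm_map, EuclideanSpace.real_norm_sq_eq]
    simp only [hv]
  have hrest : T v v v = normalForm n (κ * (1 - 2 / (n * (n + 1)))) fun i => b'.repr x i.succ :=
    (hb v).trans (congrArg _ (funext hv))
  have hexpand := hT.apply_add_self (b'.repr x 0 • e) v
  rw [← hx] at hexpand
  simp only [map_smul, LinearMap.smul_apply, smul_eq_mul, hlin, hscalar, hnorm, hrest] at hexpand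
  rw [hexpand, normalForm, ← hmax]
  ring

namespace IsAdapted

theorem eigenvalue_eq_neg_div (hb : T.IsAdapted e b) (h : T.SolvesSystem κ)
    (heq : ∀ i j, T e (b i) (b i) = T e (b j) (b j)) (i : Fin n) :
    T e (b i) (b i) = -(T e e e / n) := by
  have htrace := hb.trace_eq_zero h
  rw [Finset.sum_congr rfl fun j _ => heq j i, Finset.sum_const, Finset.card_univ,
    Fintype.card_fin, nsmul_eq_mul] at htrace
  have hn : (n : ℝ) ≠ 0 := by exact_mod_cast i.pos.ne'
  field_simp
  linarith

theorem succ_mul_sq_eq (hb : T.IsAdapted e b) (h : T.SolvesSystem κ)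
    (heq : ∀ i j, T e (b i) (b i) = T e (b j) (b j)) :
    (n + 1) * T e e e ^ 2 = n * κ := by
  have htrace := hb.trace_eq_zero h
  have hsq := hb.sum_sq_eq h
  simp only [hb.eigenvalue_eq_neg_div h heq, Finset.sum_const, Finset.card_univ, Fintype.card_fin,
    nsmul_eq_mul] at htrace hsq
  rcases eq_or_ne (n : ℝ) 0 with hn | hn
  · have hm : T e e e = 0 := by simpa [hn] using htrace
    rw [hn, hm]
    ring
  · rw [← hsq]
    field_simp

theorem hasNormalForm_succ (hb : T.IsAdapted e b) (h : T.SolvesSystem κ)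
    (heq : ∀ i j, T e (b i) (b i) = T e (b j) (b j))
    (ih : ∀ κ', (T.pullback (ℝ ∙ e)ᗮ.subtype).SolvesSystem κ' →
      (T.pullback (ℝ ∙ e)ᗮ.subtype).HasNormalForm n κ') :
    T.HasNormalForm (n + 1) κ := by
  have hmul := hb.succ_mul_sq_eq h heq
  have hmax : T e e e = √(n * κ / (n + 1)) := by
    rw [← Real.sqrt_sq hb.nonneg]
    congr 1
    field_simp
    linarith
  have hscalar := hb.apply_eq_inner (hb.eigenvalue_eq_neg_div h heq)
  have hconst : κ - 2 * (-(T e e e / n)) ^ 2 = κ * (1 - 2 / (n * (n + 1))) := by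
    rcases eq_or_ne (n : ℝ) 0 with hn | hn
    · simp [hn]
    · field_simp
      linear_combination -2 * hmul
  exact HasNormalForm.succ h.isSymm hb.norm_eq hmax hb.apply_eq_zero hscalar
    (ih _ (hconst ▸ h.pullback_perp hb.norm_eq hb.apply_eq_zero hscalar))

end IsAdapted

end TrilinForm

end NormalForm

section LowDimensions

open Module (finrank)
open scoped RealInnerProductSpace

namespace TrilinForm

section

variable {E : Type*} [NormedAddCommGroup E] [InnerProductSpace ℝ E]

/-- The cubic form `T x x x` is the sum of its restrictions to two nonzero complementary orthogonal
subspaces, expressed through the vanishing of the mixed terms. -/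
def IsDecomposable (T : TrilinForm E) : Prop :=
  ∃ V : Submodule ℝ E, V ≠ ⊥ ∧ Vᗮ ≠ ⊥ ∧ ∀ v ∈ V, ∀ w ∈ Vᗮ, T v w = 0

theorem IsDecomposable.of_orthonormalBasis {ι : Type*} [Fintype ι] {T : TrilinForm E}
    (b : OrthonormalBasis ι ℝ E) (s : Set ι) (hs : s.Nonempty) (hs' : sᶜ.Nonempty)
    (h : ∀ i ∈ s, ∀ j ∉ s, T (b i) (b j) = 0) : T.IsDecomposable := by
  obtain ⟨i, hi⟩ := hs
  obtain ⟨j, hj⟩ := hs'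
  have hmem {k : ι} (hk : k ∈ s) : b k ∈ Submodule.span ℝ (b '' s) :=
    Submodule.subset_span ⟨k, hk, rfl⟩
  have hmem' : b j ∈ (Submodule.span ℝ (b '' s))ᗮ := by
    have hortho : Submodule.span ℝ {b j} ⟂ Submodule.span ℝ (b '' s) := by
      rw [Submodule.isOrtho_span]
      rintro _ rfl _ ⟨k, hk, rfl⟩
      exact b.orthonormal.2 fun hjk => hj (hjk ▸ hk)
    exact hortho (Submodule.mem_span_singleton_self _)
  refine ⟨Submodule.span ℝ (b '' s), ?_, ?_, fun v hv w hw => ?_⟩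
  · exact (Submodule.ne_bot_iff _).2 ⟨b i, hmem hi, b.orthonormal.ne_zero i⟩
  · exact (Submodule.ne_bot_iff _).2 ⟨b j, hmem', b.orthonormal.ne_zero j⟩
  have hker : Submodule.span ℝ (b '' s) ≤ LinearMap.ker (T.flip w) := by
    rw [Submodule.span_le]
    rintro _ ⟨k, hk, rfl⟩
    rw [SetLike.mem_coe, LinearMap.mem_ker, LinearMap.flip_apply, ← b.sum_repr' w, map_sum]
    refine Finset.sum_eq_zero fun l _ => ?_
    by_cases hl : l ∈ s
    · rw [Submodule.inner_right_of_mem_orthogonal (hmem hl) hw, zero_smul, map_zero]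
    · rw [map_smul, h k hk l hl, smul_zero]
  exact hker hv

variable [FiniteDimensional ℝ E] {κ : ℝ} {T : TrilinForm E} {e : E}

theorem IsAdapted.eigenvalue_eq_of_two {b : OrthonormalBasis (Fin 2) ℝ (ℝ ∙ e)ᗮ}
    (hb : T.IsAdapted e b) (h : T.SolvesSystem κ) : T e (b 0) (b 0) = T e (b 1) (b 1) := by
  by_contra hne
  have hdiag (a : Fin 2) : ∀ i, T (b a) (b i) (b i) = 0 := by
    have htrace := hb.sum_perp_eq_zero h a
    have hmixed := hb.sum_mul_perp_eq_zero h a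
    rw [Fin.sum_univ_two] at htrace hmixed
    have hzero : T (b a) (b 0) (b 0) = 0 := by
      refine (mul_eq_zero.1 ?_).resolve_left (sub_ne_zero.2 hne)
      linear_combination hmixed - T e (b 1) (b 1) * htrace
    exact Fin.forall_fin_two.2 ⟨hzero, by linarith⟩
  have hvanish (a i j : Fin 2) : T (b a) (b i) (b j) = 0 := by
    obtain rfl | rfl | rfl : i = j ∨ a = i ∨ a = j := by lia
    · exact hdiag a i
    · rw [h.isSymm.swap_right, h.isSymm.swap_left, hdiag]
    · rw [h.isSymm.swap_left, hdiag]
  have hsq (a : Fin 2) : 2 * T e (b a) (b a) ^ 2 = κ := by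
    have hess := hb.sum_sum_perp_eq h a a
    simp only [hvanish, mul_zero, Finset.sum_const_zero, if_true] at hess
    linarith
  have hsum : T e (b 0) (b 0) + T e (b 1) (b 1) = 0 := by
    refine (mul_eq_zero.1 ?_).resolve_left (sub_ne_zero.2 hne)
    linear_combination (hsq 0 - hsq 1) / 2
  have htrace := hb.trace_eq_zero h
  rw [Fin.sum_univ_two] at htrace
  exact hne (by linarith [hb.two_mul_le 0, hb.two_mul_le 1])

end

theorem SolvesSystem.hasNormalForm_of_le_three {E : Type*} [NormedAddCommGroup E]
    [InnerProductSpace ℝ E] [FiniteDimensional ℝ E] {κ : ℝ} {T : TrilinForm E} {n : ℕ}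
    (h : T.SolvesSystem κ) (hE : finrank ℝ E = n) (hn : n ≤ 3) : T.HasNormalForm n κ := by
  induction n generalizing E κ with
  | zero =>
    have : Subsingleton E := Module.finrank_zero_iff.1 hE
    refine ⟨(stdOrthonormalBasis ℝ E).reindex (finCongr hE), fun x => ?_⟩
    rw [Subsingleton.elim x 0, map_zero, normalForm]
  | succ n ih =>
    obtain ⟨e, b, hb⟩ := h.isSymm.exists_isAdapted hE
    have hdim : finrank ℝ (ℝ ∙ e)ᗮ = n := by
      rw [Module.finrank_eq_card_basis b.toBasis, Fintype.card_fin]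
    refine hb.hasNormalForm_succ h ?_ fun κ' h' => ih h' hdim (by lia)
    have hn_le : n ≤ 2 := by lia
    interval_cases n
    · exact fun i => i.elim0
    · exact fun i j => by rw [Subsingleton.elim i j]
    · have heq := hb.eigenvalue_eq_of_two h
      simp [Fin.forall_fin_two, heq]

end TrilinForm

end LowDimensions

section EigenvalueSystem

/-- The equations satisfied by the value `m` and the Hessian eigenvalues `m, l 0, l 1, l 2` at a
maximum point of a cubic form in four variables solving the system. In an eigenbasis its restriction
to the complement has coefficients `c i j j = t i * (l (j + 1) - l (j + 2))` and `c 0 1 2 = s`;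
indices are read modulo three. -/
structure EigenvalueSystem (m : ℝ) (l t : Fin 3 → ℝ) (s : ℝ) : Prop where
  pos : 0 < m
  trace (i : Fin 3) : m + l i + l (i + 1) + l (i + 2) = 0
  two_mul_le (i : Fin 3) : 2 * l i ≤ m
  off (i : Fin 3) :
    (l i - l (i + 1)) * (t i * t (i + 1) * (l i - l (i + 1)) - s * t (i + 2)) = 0
  diag (i : Fin 3) :
    t i ^ 2 * ((l i - l (i + 1)) ^ 2 + (l (i + 1) - l (i + 2)) ^ 2 + (l (i + 2) - l i) ^ 2)
      + 2 * ((t (i + 1) ^ 2 + t (i + 2) ^ 2) * (l (i + 1) - l (i + 2)) ^ 2 + s ^ 2) =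
      m ^ 2 - l i ^ 2 + l (i + 1) ^ 2 + l (i + 2) ^ 2

namespace EigenvalueSystem

variable {m s : ℝ} {l t : Fin 3 → ℝ}

theorem rotate (h : EigenvalueSystem m l t s) (a : Fin 3) :
    EigenvalueSystem m (fun i => l (a + i)) (fun i => t (a + i)) s where
  pos := h.pos
  trace i := by simpa only [add_assoc] using h.trace (a + i)
  two_mul_le i := h.two_mul_le (a + i)
  off i := by simpa only [add_assoc] using h.off (a + i)
  diag i := by simpa only [add_assoc] using h.diag (a + i)

theorem eq_zero_of_eq (h : EigenvalueSystem m l t s) (h01 : l 0 = l 1) (h12 : l 1 ≠ l 2) :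
    l 0 = 0 ∧ l 1 = 0 ∧ t 2 = 0 ∧ s = 0 := by
  have hne := sub_ne_zero.2 h12
  have hpos := h.pos
  have htrace : m + l 0 + l 1 + l 2 = 0 := h.trace 0
  have hle0 := h.two_mul_le 0
  have hle2 := h.two_mul_le 2
  have hdiag0 := h.diag 0
  have hdiag2 := h.diag 2
  have hoff1 : t 1 * t 2 * (l 1 - l 2) - s * t 0 = 0 := (mul_eq_zero.1 (h.off 1)).resolve_left hne
  have hoff2 : t 2 * t 0 * (l 2 - l 0) - s * t 1 = 0 :=
    (mul_eq_zero.1 (h.off 2)).resolve_left (sub_ne_zero.2 (h01 ▸ h12.symm))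
  simp only [Fin.reduceAdd, zero_add, h01] at hdiag0 hdiag2 hoff1 hoff2 htrace hle0 ⊢
  obtain rfl : m = -(2 * l 1 + l 2) := by linarith
  have hs : (t 0 ^ 2 + t 1 ^ 2) * s = 0 := by linear_combination (-t 0) * hoff1 - t 1 * hoff2
  have ht2 : (l 1 - l 2) * (t 0 ^ 2 + t 1 ^ 2) * t 2 = 0 := by
    linear_combination t 1 * hoff1 - t 0 * hoff2
  by_cases ht : t 0 ^ 2 + t 1 ^ 2 = 0
  · obtain ⟨ht0, ht1⟩ : t 0 = 0 ∧ t 1 = 0 := ⟨by nlinarith, by nlinarith⟩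
    rw [ht0, ht1] at hdiag0 hdiag2
    have hsum : (l 1 - l 2) * (l 1 + l 2) = 0 := by linarith
    linarith [(mul_eq_zero.1 hsum).resolve_left hne]
  · obtain rfl : s = 0 := (mul_eq_zero.1 hs).resolve_left ht
    have ht2 : t 2 = 0 := (mul_eq_zero.1 ht2).resolve_left (mul_ne_zero hne ht)
    rw [ht2] at hdiag2
    have hl : l 1 * (6 * l 1 + 4 * l 2) = 0 := by linarith
    have hl1 : l 1 = 0 := (mul_eq_zero.1 hl).resolve_right fun hl => by linarith
    exact ⟨hl1, hl1, ht2, rfl⟩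

theorem eq_or_eq_or_eq_of_eq_zero (h : EigenvalueSystem m l t s) (ht1 : t 1 = 0) (ht2 : t 2 = 0)
    (hs : s = 0) : l 0 = l 1 ∨ l 1 = l 2 ∨ l 2 = l 0 := by
  by_contra! hne
  obtain ⟨h01, h12, h20⟩ := hne
  have hdiag0 := h.diag 0
  have hdiag1 := h.diag 1
  have hdiag2 := h.diag 2
  simp only [Fin.reduceAdd, zero_add, ht1, ht2, hs] at hdiag0 hdiag1 hdiag2
  have htrace : m + l 0 + l 1 + l 2 = 0 := h.trace 0
  obtain rfl : m = -(l 0 + l 1 + l 2) := by linarith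
  have hlin : t 0 ^ 2 * (l 1 + l 2 - 2 * l 0) = l 1 + l 2 :=
    mul_left_cancel₀ (sub_ne_zero.2 h12) (by linarith)
  have hquad : t 0 ^ 2 * (l 1 - l 2) ^ 2 = l 1 ^ 2 + l 2 ^ 2 - 2 * l 0 ^ 2 := by linarith
  have hdisc : (l 1 - l 2) ^ 2 = (l 1 + l 2) ^ 2 + 12 * l 0 * (l 1 + l 2) + 12 * l 0 ^ 2 := by
    linear_combination 2 * (hdiag1 + hdiag2) - 2 * hquad - 2 * (l 1 + l 2 - 2 * l 0) * hlin
  have hprod : l 0 * ((2 * (l 1 + l 2) + l 0) * (l 1 + l 2 + 2 * l 0)) = 0 := by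
    linear_combination ((l 1 + l 2 - 2 * l 0) * hquad - (l 1 - l 2) ^ 2 * hlin) / 4
      - ((l 1 + l 2) / 8 + l 0 / 4) * hdisc
  rcases mul_eq_zero.1 hprod with h0 | h0
  · have hmul : l 1 * l 2 = 0 := by rw [h0] at hdisc; linarith
    rcases mul_eq_zero.1 hmul with h1 | h2
    · exact h01 (h0.trans h1.symm)
    · exact h20 (h2.trans h0.symm)
  rcases mul_eq_zero.1 h0 with h0 | h0
  · have h0 : l 0 = -2 * (l 1 + l 2) := by linarith
    have hmul : (2 * l 1 + 3 * l 2) * (3 * l 1 + 2 * l 2) = 0 := by rw [h0] at hdisc; linarith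
    rcases mul_eq_zero.1 hmul with h1 | h1
    · exact h20 (by linarith)
    · exact h01 (by linarith)
  · have hsum : l 1 + l 2 = -2 * l 0 := by linarith
    rw [hsum] at hdisc
    exact h12 (by nlinarith [sq_nonneg (l 0)])

theorem eq_or_eq_or_eq (h : EigenvalueSystem m l t s) :
    l 0 = l 1 ∨ l 1 = l 2 ∨ l 2 = l 0 := by
  by_contra! hne
  obtain ⟨h01, h12, h20⟩ := hne
  replace h01 := sub_ne_zero.2 h01
  replace h12 := sub_ne_zero.2 h12
  replace h20 := sub_ne_zero.2 h20
  have hoff0 : t 0 * t 1 * (l 0 - l 1) - s * t 2 = 0 := (mul_eq_zero.1 (h.off 0)).resolve_left h01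
  have hoff1 : t 1 * t 2 * (l 1 - l 2) - s * t 0 = 0 := (mul_eq_zero.1 (h.off 1)).resolve_left h12
  have hoff2 : t 2 * t 0 * (l 2 - l 0) - s * t 1 = 0 := (mul_eq_zero.1 (h.off 2)).resolve_left h20
  have hprod : s * (t 0 ^ 2 + t 1 ^ 2 + t 2 ^ 2) = 0 := by
    linear_combination (-t 2) * hoff0 - t 0 * hoff1 - t 1 * hoff2
  rcases mul_eq_zero.1 hprod with hs | ht
  · have hpair : (t 0 = 0 ∨ t 1 = 0) ∧ (t 1 = 0 ∨ t 2 = 0) ∧ (t 2 = 0 ∨ t 0 = 0) := by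
      simpa [hs, h01, h12, h20] using And.intro hoff0 (And.intro hoff1 hoff2)
    rw [sub_ne_zero] at h01 h12 h20
    obtain ht | ht | ht : t 1 = 0 ∧ t 2 = 0 ∨ t 2 = 0 ∧ t 0 = 0 ∨ t 0 = 0 ∧ t 1 = 0 := by tauto
    · have := h.eq_or_eq_or_eq_of_eq_zero ht.1 ht.2 hs
      tauto
    · have := (h.rotate 1).eq_or_eq_or_eq_of_eq_zero ht.1 ht.2 hs
      simp only [Fin.reduceAdd, add_zero] at this
      tauto
    · have := (h.rotate 2).eq_or_eq_or_eq_of_eq_zero ht.1 ht.2 hs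
      simp only [Fin.reduceAdd, add_zero] at this
      tauto
  · obtain ⟨ht0, ht1, ht2⟩ : t 0 = 0 ∧ t 1 = 0 ∧ t 2 = 0 := by
      refine ⟨?_, ?_, ?_⟩ <;> nlinarith [sq_nonneg (t 0), sq_nonneg (t 1), sq_nonneg (t 2)]
    have hdiag0 := h.diag 0
    have hdiag1 := h.diag 1
    have hdiag2 := h.diag 2
    simp only [Fin.reduceAdd, zero_add, ht0, ht1, ht2] at hdiag0 hdiag1 hdiag2
    have hsum01 : l 0 + l 1 = 0 := (mul_eq_zero.1 (by linarith)).resolve_left h01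
    have hsum12 : l 1 + l 2 = 0 := (mul_eq_zero.1 (by linarith)).resolve_left h12
    exact h20 (by linarith)

theorem exists_eq_zero (h : EigenvalueSystem m l t s) (hne : ¬ ∀ i j, l i = l j) :
    ∃ a, l a = 0 ∧ l (a + 1) = 0 ∧ t (a + 2) = 0 ∧ s = 0 := by
  have hne : ¬(l 0 = l 1 ∧ l 1 = l 2) := fun heq => hne (by simp [Fin.forall_fin_succ, heq])
  have hkey (a : Fin 3) (h01 : l a = l (a + 1)) (h12 : l (a + 1) ≠ l (a + 2)) :=
    (h.rotate a).eq_zero_of_eq (by simpa using h01) h12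
  simp only [add_zero] at hkey
  rcases h.eq_or_eq_or_eq with h01 | h12 | h20
  · exact ⟨0, hkey 0 h01 fun h12 => hne ⟨h01, h12⟩⟩
  · exact ⟨1, hkey 1 h12 fun h20 => hne ⟨h20.symm.trans h12.symm, h12⟩⟩
  · exact ⟨2, hkey 2 h20 fun h01 => hne ⟨h01, h01.symm.trans h20.symm⟩⟩

end EigenvalueSystem

end EigenvalueSystem

section FourDimensions

open Module (finrank)
open scoped RealInnerProductSpace

theorem sum_fin_three_eq (i : Fin 3) (f : Fin 3 → ℝ) : ∑ j, f j = f i + f (i + 1) + f (i + 2) := by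
  rw [← Equiv.sum_comp (Equiv.addLeft i), Fin.sum_univ_three]
  simp only [Equiv.coe_addLeft, add_zero]

theorem exists_eq_mul_cross {l a : Fin 3 → ℝ} (hl : ¬ ∀ i j, l i = l j) (hsum : ∑ i, a i = 0)
    (hmul : ∑ i, l i * a i = 0) : ∃ t, ∀ i, a i = t * (l (i + 1) - l (i + 2)) := by
  have hnext (i : Fin 3) : a i * (l (i + 2) - l i) = a (i + 1) * (l (i + 1) - l (i + 2)) := by
    rw [sum_fin_three_eq i] at hsum hmul
    linear_combination l (i + 2) * hsum - hmul
  have hcross (i j : Fin 3) : a i * (l (j + 1) - l (j + 2)) = a j * (l (i + 1) - l (i + 2)) := by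
    obtain rfl | rfl | rfl : j = i ∨ j = i + 1 ∨ i = j + 1 := by lia
    · rfl
    · simpa only [add_assoc, Fin.reduceAdd, add_zero] using hnext i
    · simpa only [add_assoc, Fin.reduceAdd, add_zero] using (hnext j).symm
  obtain ⟨j, hj⟩ : ∃ j, l (j + 1) - l (j + 2) ≠ 0 := by
    contrapose! hl
    have h12 : l 1 = l 2 := sub_eq_zero.1 (hl 0)
    have h20 : l 2 = l 0 := sub_eq_zero.1 (hl 1)
    simp [Fin.forall_fin_succ, h12, h20]
  refine ⟨a j / (l (j + 1) - l (j + 2)), fun i => ?_⟩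
  rw [div_mul_eq_mul_div, eq_div_iff hj, hcross]

section

variable {E : Type*} [AddCommGroup E] [Module ℝ E]

theorem TrilinForm.IsSymm.apply_rotate {T : TrilinForm E} (hT : T.IsSymm) (b : Fin 3 → E)
    (i : Fin 3) : T (b i) (b (i + 1)) (b (i + 2)) = T (b 0) (b 1) (b 2) := by
  fin_cases i
  · rfl
  · exact (hT.swap_right ..).trans (hT.swap_left ..)
  · exact (hT.swap_left ..).trans (hT.swap_right ..)

end

variable {E : Type*} [NormedAddCommGroup E] [InnerProductSpace ℝ E] [FiniteDimensional ℝ E]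

theorem linearMap_eq_zero_of_perp {n : ℕ} {e : E} (he : ‖e‖ = 1)
    (b : OrthonormalBasis (Fin n) ℝ (ℝ ∙ e)ᗮ) {f : E →ₗ[ℝ] ℝ} (hfe : f e = 0)
    (hf : ∀ i, f (b i) = 0) : f = 0 := by
  obtain ⟨b', hb'_zero, hb'_succ⟩ := exists_orthonormalBasis_cons he b
  refine b'.toBasis.ext <| Fin.cases ?_ fun i => ?_
  · simp [hb'_zero, hfe]
  · simp [hb'_succ, hf]

namespace TrilinForm

theorem IsAdapted.isDecomposable_of_forall_ne {n : ℕ} {T : TrilinForm E} {e : E}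
    {b : OrthonormalBasis (Fin n) ℝ (ℝ ∙ e)ᗮ} (hb : T.IsAdapted e b) (hT : T.IsSymm) {p q : Fin n}
    (hpq : q ≠ p) (hzero : ∀ i ≠ p, T e (b i) (b i) = 0)
    (hp : ∀ i ≠ p, ∀ j, T (b p) (b i) (b j) = 0) : T.IsDecomposable := by
  obtain ⟨b', hb'_zero, hb'_succ⟩ := exists_orthonormalBasis_cons hb.norm_eq b
  refine .of_orthonormalBasis b' {0, p.succ} ⟨0, .inl rfl⟩
    ⟨q.succ, by simp [Fin.succ_ne_zero, hpq]⟩ fun i hi j hj => ?_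
  obtain ⟨j, rfl⟩ := Fin.exists_succ_eq.2 fun hj0 : j = 0 => hj (.inl hj0)
  have hj : j ≠ p := fun hjp => hj (.inr (congrArg Fin.succ hjp))
  rcases hi with rfl | rfl <;> simp only [hb'_zero, hb'_succ]
  · refine linearMap_eq_zero_of_perp hb.norm_eq b ?_ fun k => ?_
    · rw [hT.swap_right, hb.apply_perp]
    · rcases eq_or_ne j k with rfl | hjk
      · exact hzero j hj
      · exact hb.apply_of_ne hjk
  · refine linearMap_eq_zero_of_perp hb.norm_eq b ?_ (hp j hj)
    rw [hT.swap_right, hT.swap_left, hb.apply_of_ne hj.symm]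

variable {κ : ℝ} {T : TrilinForm E} {e : E} {b : OrthonormalBasis (Fin 3) ℝ (ℝ ∙ e)ᗮ}

theorem IsAdapted.exists_apply_eq_mul_cross (hb : T.IsAdapted e b) (h : T.SolvesSystem κ)
    (hne : ¬ ∀ i j, T e (b i) (b i) = T e (b j) (b j)) :
    ∃ t : Fin 3 → ℝ, ∀ i j, T (b i) (b j) (b j) =
      t i * (T e (b (j + 1)) (b (j + 1)) - T e (b (j + 2)) (b (j + 2))) := by
  choose t ht using fun i => exists_eq_mul_cross (l := fun j => T e (b j) (b j)) hne
    (hb.sum_perp_eq_zero h i) (hb.sum_mul_perp_eq_zero h i)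
  exact ⟨t, ht⟩

theorem IsAdapted.eigenvalueSystem (hb : T.IsAdapted e b) (h : T.SolvesSystem κ) (hκ : 0 < κ)
    {t : Fin 3 → ℝ} (ht : ∀ i j, T (b i) (b j) (b j) =
      t i * (T e (b (j + 1)) (b (j + 1)) - T e (b (j + 2)) (b (j + 2)))) :
    EigenvalueSystem (T e e e) (fun i => T e (b i) (b i)) t (T (b 0) (b 1) (b 2)) := by
  have ht' (i j : Fin 3) : T (b i) (b j) (b i) =
      t j * (T e (b (i + 1)) (b (i + 1)) - T e (b (i + 2)) (b (i + 2))) := by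
    rw [h.isSymm.swap_left, ht]
  have ht'' (i j : Fin 3) : T (b i) (b i) (b j) =
      t j * (T e (b (i + 1)) (b (i + 1)) - T e (b (i + 2)) (b (i + 2))) := by
    rw [h.isSymm.swap_right, ht']
  have hs (i : Fin 3) : T (b i) (b (i + 1)) (b (i + 2)) = T (b 0) (b 1) (b 2) :=
    h.isSymm.apply_rotate (fun i => (b i : E)) i
  have hs' (i : Fin 3) : T (b i) (b (i + 2)) (b (i + 1)) = T (b 0) (b 1) (b 2) :=
    (h.isSymm.swap_right ..).trans (hs i)
  refine ⟨hb.pos h hκ, fun i => ?_, hb.two_mul_le, fun i => ?_, fun i => ?_⟩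
  · linarith [hb.trace_eq_zero h, sum_fin_three_eq i fun j => T e (b j) (b j)]
  · have hsum := hb.sum_sum_perp_eq h i (i + 1)
    have hs_next := hs (i + 1)
    have hs'_next := hs' (i + 1)
    rw [if_neg (by simp)] at hsum
    simp only [sum_fin_three_eq i, ht, ht', ht'', hs, hs', add_assoc, Fin.reduceAdd, add_zero]
      at hsum hs_next hs'_next ⊢
    rw [hs_next, hs'_next] at hsum
    linarith
  · have hsum := hb.sum_sum_perp_eq h i i
    rw [if_pos rfl, ← hb.sum_sq_eq h] at hsum
    simp only [sum_fin_three_eq i, ht, ht', ht'', hs, hs', add_assoc, Fin.reduceAdd, add_zero]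
      at hsum ⊢
    linarith

theorem IsAdapted.isDecomposable (hb : T.IsAdapted e b) (h : T.SolvesSystem κ) (hκ : 0 < κ)
    (hne : ¬ ∀ i j, T e (b i) (b i) = T e (b j) (b j)) : T.IsDecomposable := by
  obtain ⟨t, ht⟩ := hb.exists_apply_eq_mul_cross h hne
  obtain ⟨a, ha, ha', hta, hs⟩ := (hb.eigenvalueSystem h hκ ht).exists_eq_zero hne
  refine hb.isDecomposable_of_forall_ne h.isSymm (p := a + 2) (q := a) (by simp) ?_ ?_
  · intro i hi
    obtain rfl | rfl : i = a ∨ i = a + 1 := by lia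
    exacts [ha, ha']
  · have hs_rotate := h.isSymm.apply_rotate (fun i => (b i : E)) (a + 2)
    simp only [add_assoc, Fin.reduceAdd, add_zero, hs] at hs_rotate
    intro i hi j
    obtain rfl | rfl | hij : j = i ∨ j = a + 2 ∨ i = a ∧ j = a + 1 ∨ i = a + 1 ∧ j = a := by lia
    · rw [ht, hta, zero_mul]
    · rw [h.isSymm.swap_left, ht]
      simp only [add_assoc, Fin.reduceAdd, add_zero, ha, ha', sub_zero, mul_zero]
    · rcases hij with ⟨rfl, rfl⟩ | ⟨rfl, rfl⟩
      · exact hs_rotate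
      · rw [h.isSymm.swap_right, hs_rotate]

theorem SolvesSystem.isDecomposable_or_hasNormalForm (h : T.SolvesSystem κ) (hκ : 0 < κ)
    (hE : finrank ℝ E = 4) : T.IsDecomposable ∨ T.HasNormalForm 4 κ := by
  obtain ⟨e, b, hb⟩ := h.isSymm.exists_isAdapted hE
  by_cases heq : ∀ i j, T e (b i) (b i) = T e (b j) (b j)
  · have hdim : finrank ℝ (ℝ ∙ e)ᗮ = 3 := by
      rw [Module.finrank_eq_card_basis b.toBasis, Fintype.card_fin]
    exact .inr (hb.hasNormalForm_succ h heq fun κ' h' => h'.hasNormalForm_of_le_three hdim le_rfl)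
  · exact .inl (hb.isDecomposable h hκ heq)

end TrilinForm

end FourDimensions

section PolarForms

open MvPolynomial
open scoped RealInnerProductSpace

variable {n : ℕ}

theorem polyFun_injective : Function.Injective (polyFun (n := n)) := fun _ _ h =>
  MvPolynomial.funext fun x => congrFun h (WithLp.toLp 2 x)

theorem pderiv_pderiv_comm {σ R : Type*} [CommRing R] (i j : σ) (P : MvPolynomial σ R) :
    pderiv i (pderiv j P) = pderiv j (pderiv i P) := by
  classical
  have hbracket : ⁅(pderiv i : Derivation R (MvPolynomial σ R) (MvPolynomial σ R)), pderiv j⁆ = 0 :=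
    derivation_ext fun k => by
      rw [Derivation.commutator_apply]
      simp [pderiv_X, Pi.single_apply, apply_ite]
  exact sub_eq_zero.1 (DFunLike.congr_fun hbracket P)

/-- The directional derivative `x ↦ ∑ i, x i • ∂ᵢ` of polynomials on `ℝⁿ`. -/
noncomputable def dirDeriv :
    EuclideanSpace ℝ (Fin n) →ₗ[ℝ] MvPolynomial (Fin n) ℝ →ₗ[ℝ] MvPolynomial (Fin n) ℝ :=
  ∑ i, (EuclideanSpace.proj i).toLinearMap.smulRight (pderiv i).toLinearMap

theorem dirDeriv_apply (x : EuclideanSpace ℝ (Fin n)) (P : MvPolynomial (Fin n) ℝ) :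
    dirDeriv x P = ∑ i, x i • pderiv i P := by
  simp [dirDeriv]

theorem dirDeriv_single (i : Fin n) (P : MvPolynomial (Fin n) ℝ) :
    dirDeriv (EuclideanSpace.single i 1) P = pderiv i P := by
  simp [dirDeriv_apply]

theorem dirDeriv_comm (x y : EuclideanSpace ℝ (Fin n)) (P : MvPolynomial (Fin n) ℝ) :
    dirDeriv x (dirDeriv y P) = dirDeriv y (dirDeriv x P) := by
  simp only [dirDeriv_apply, map_sum, Derivation.map_smul]
  rw [Finset.sum_comm]
  refine Finset.sum_congr rfl fun i _ => Finset.sum_congr rfl fun j _ => ?_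
  rw [smul_comm, pderiv_pderiv_comm]

theorem dirDeriv_isHomogeneous {P : MvPolynomial (Fin n) ℝ} {m : ℕ} (hP : P.IsHomogeneous (m + 1))
    (x : EuclideanSpace ℝ (Fin n)) : (dirDeriv x P).IsHomogeneous m := by
  rw [dirDeriv_apply]
  exact IsHomogeneous.sum _ _ _ fun i _ => by
    rw [smul_eq_C_mul]
    simpa using (isHomogeneous_C _ (x i)).mul hP.pderiv

theorem polyFun_dirDeriv_self {P : MvPolynomial (Fin n) ℝ} {m : ℕ} (hP : P.IsHomogeneous m)
    (x : EuclideanSpace ℝ (Fin n)) : polyFun (dirDeriv x P) x = m * polyFun P x := by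
  have heuler := congrArg (eval fun i => x i) hP.sum_X_mul_pderiv
  simpa [polyFun, dirDeriv_apply] using heuler

/-- The third derivative of `P` at the origin, as a trilinear form. -/
noncomputable def polarForm (P : MvPolynomial (Fin n) ℝ) : TrilinForm (EuclideanSpace ℝ (Fin n)) :=
  (dirDeriv.flip ∘ₗ dirDeriv.flip P).compr₂ (dirDeriv.flip.compr₂ (lcoeff ℝ 0))

theorem polarForm_apply (P : MvPolynomial (Fin n) ℝ) (x y z : EuclideanSpace ℝ (Fin n)) :
    polarForm P x y z = coeff 0 (dirDeriv z (dirDeriv y (dirDeriv x P))) := rfl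

theorem polarForm_isSymm (P : MvPolynomial (Fin n) ℝ) : (polarForm P).IsSymm where
  swap_left x y z := by rw [polarForm_apply, polarForm_apply, dirDeriv_comm y x]
  swap_right x y z := by rw [polarForm_apply, polarForm_apply, dirDeriv_comm z y]

variable {P : MvPolynomial (Fin n) ℝ}

theorem polarForm_apply_eq_polyFun (hP : P.IsHomogeneous 3) (x y z : EuclideanSpace ℝ (Fin n)) :
    polarForm P x y z = polyFun (dirDeriv y (dirDeriv x P)) z := by
  have hlinear := dirDeriv_isHomogeneous (dirDeriv_isHomogeneous hP x) y
  have hconst := totalDegree_eq_zero_iff_eq_C.1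
    ((totalDegree_zero_iff_isHomogeneous _).2 (dirDeriv_isHomogeneous hlinear z))
  rw [polarForm_apply, ← one_mul (polyFun _ z), ← Nat.cast_one, ← polyFun_dirDeriv_self hlinear,
    hconst]
  simp [polyFun]

theorem polarForm_apply_self_right (hP : P.IsHomogeneous 3) (x y : EuclideanSpace ℝ (Fin n)) :
    polarForm P x y y = 2 * polyFun (dirDeriv x P) y := by
  rw [polarForm_apply_eq_polyFun hP, polyFun_dirDeriv_self (dirDeriv_isHomogeneous hP x)]
  rfl

theorem polarForm_apply_self (hP : P.IsHomogeneous 3) (x : EuclideanSpace ℝ (Fin n)) :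
    polarForm P x x x = 6 * polyFun P x := by
  rw [polarForm_apply_self_right hP, polyFun_dirDeriv_self hP]
  push_cast
  ring

theorem polarForm_eq (hP : P.IsHomogeneous 3) {T : TrilinForm (EuclideanSpace ℝ (Fin n))}
    (hT : T.IsSymm) (hPT : ∀ x, T x x x = 6 * polyFun P x) : polarForm P = T :=
  (polarForm_isSymm P).ext_diag hT fun x => by rw [polarForm_apply_self hP, hPT]

theorem polarForm_apply_basisFun (hP : P.IsHomogeneous 3) (x : EuclideanSpace ℝ (Fin n))
    (i j : Fin n) : polarForm P x (EuclideanSpace.basisFun (Fin n) ℝ i)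
      (EuclideanSpace.basisFun (Fin n) ℝ j) = polyFun (pderiv i (pderiv j P)) x := by
  rw [(polarForm_isSymm P).swap_right, (polarForm_isSymm P).swap_left,
    (polarForm_isSymm P).swap_right, polarForm_apply_eq_polyFun hP, EuclideanSpace.basisFun_apply,
    EuclideanSpace.basisFun_apply, dirDeriv_single, dirDeriv_single]

theorem polyFun_polyLaplacian (hP : P.IsHomogeneous 3) (x : EuclideanSpace ℝ (Fin n)) :
    polyFun (polyLaplacian P) x = ∑ i, polarForm P x (EuclideanSpace.basisFun (Fin n) ℝ i)
      (EuclideanSpace.basisFun (Fin n) ℝ i) := by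
  simp only [polarForm_apply_basisFun hP, polyFun, polyLaplacian, map_sum]

theorem polyFun_polyHessNormSq (hP : P.IsHomogeneous 3) (x : EuclideanSpace ℝ (Fin n)) :
    polyFun (polyHessNormSq P) x = ∑ i, ∑ j, polarForm P x (EuclideanSpace.basisFun (Fin n) ℝ i)
      (EuclideanSpace.basisFun (Fin n) ℝ j) ^ 2 := by
  simp only [polarForm_apply_basisFun hP, polyFun, polyHessNormSq, map_sum, map_pow]

theorem polyFun_C_mul_sum_X_sq (κ : ℝ) (x : EuclideanSpace ℝ (Fin n)) :
    polyFun (C κ * ∑ i, X i ^ 2) x = κ * ⟪x, x⟫ := by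
  simp [polyFun, EuclideanSpace.real_norm_sq_eq]

theorem sum_sum_mul_eq_mul_inner {E : Type*} [NormedAddCommGroup E] [InnerProductSpace ℝ E]
    {ι : Type*} [Fintype ι] {T : TrilinForm E} {κ : ℝ} (b : ι → E)
    (h : ∀ x, ∑ i, ∑ j, T x (b i) (b j) ^ 2 = κ * ⟪x, x⟫) (x y : E) :
    ∑ i, ∑ j, T x (b i) (b j) * T y (b i) (b j) = κ * ⟪x, y⟫ := by
  have hadd := h (x + y)
  simp only [map_add, LinearMap.add_apply, add_sq, mul_assoc, Finset.sum_add_distrib,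
    ← Finset.mul_sum, h, inner_add_left, inner_add_right, real_inner_comm x y] at hadd
  linarith

theorem solvesSystem_iff_polarForm (hP : P.IsHomogeneous 3) {κ : ℝ} :
    SolvesSystem κ P ↔ (polarForm P).SolvesSystem κ := by
  let b := EuclideanSpace.basisFun (Fin n) ℝ
  constructor
  · rintro ⟨hharm, hhess⟩
    refine .of_orthonormalBasis b (polarForm_isSymm P) (fun x => ?_)
      (sum_sum_mul_eq_mul_inner b fun x => ?_)
    · rw [← polyFun_polyLaplacian hP, hharm, polyFun, map_zero]
    · rw [← polyFun_polyHessNormSq hP, hhess, polyFun_C_mul_sum_X_sq]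
  · refine fun h => ⟨polyFun_injective (funext fun x => ?_), polyFun_injective (funext fun x => ?_)⟩
    · rw [polyFun_polyLaplacian hP, h.trace b, polyFun, map_zero]
    · rw [polyFun_polyHessNormSq hP, polyFun_C_mul_sum_X_sq, ← h.hess b]
      simp only [sq, b]

theorem TrilinForm.IsDecomposable.orthogonallyDecomposable (hP : P.IsHomogeneous 3)
    (h : (polarForm P).IsDecomposable) : OrthogonallyDecomposable P := by
  obtain ⟨V, hV, hV', hzero⟩ := h
  refine ⟨V, Vᗮ, hV, hV', V.isCompl_orthogonal,
    Submodule.isOrtho_orthogonal_right V, fun v hv w hw => ?_⟩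
  have hadd := (polarForm_isSymm P).apply_add_self v w
  rw [(polarForm_isSymm P).swap_right v v w, hzero v hv w hw] at hadd
  simp only [LinearMap.zero_apply, polarForm_apply_self hP] at hadd
  linarith

theorem orthogonallyEquivalent_of_solvesSystem {κ : ℝ} {P Q : MvPolynomial (Fin 4) ℝ} (hκ : 0 < κ)
    (hP : P.IsHomogeneous 3) (hQ : Q.IsHomogeneous 3) (hP' : ¬ OrthogonallyDecomposable P)
    (hQ' : ¬ OrthogonallyDecomposable Q) (hPκ : SolvesSystem κ P) (hQκ : SolvesSystem κ Q) :
    OrthogonallyEquivalent P Q := by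
  have hnormal {R : MvPolynomial (Fin 4) ℝ} (hR : R.IsHomogeneous 3)
      (hR' : ¬ OrthogonallyDecomposable R) (hRκ : SolvesSystem κ R) :
      (polarForm R).HasNormalForm 4 κ :=
    (((solvesSystem_iff_polarForm hR).1 hRκ).isDecomposable_or_hasNormalForm hκ
      finrank_euclideanSpace_fin).resolve_left fun h => hR' (h.orthogonallyDecomposable hR)
  obtain ⟨g, hg⟩ := (hnormal hP hP' hPκ).exists_isometryEquiv (hnormal hQ hQ' hQκ)
  refine ⟨g, funext fun x => ?_⟩
  have hgx := hg x
  rw [polarForm_apply_self hP, polarForm_apply_self hQ] at hgx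
  exact mul_left_cancel₀ (by norm_num) hgx

variable {Q : MvPolynomial (Fin n) ℝ}

theorem OrthogonallyDecomposable.isDecomposable (hP : P.IsHomogeneous 3)
    (h : OrthogonallyDecomposable P) : (polarForm P).IsDecomposable := by
  obtain ⟨V, W, hV, hW, hVW, hortho, hadd⟩ := h
  obtain rfl : W = Vᗮ := (Submodule.isOrtho_iff_le.1 hortho.symm).antisymm fun x hx => by
    obtain ⟨v, hv, w, hw, rfl⟩ := Submodule.mem_sup.1
      (hVW.sup_eq_top ▸ Submodule.mem_top : x ∈ V ⊔ W)
    have hv0 : v = 0 := by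
      have hvx := hx v hv
      rwa [inner_add_right, hortho.inner_eq hv hw, add_zero, inner_self_eq_zero] at hvx
    rwa [hv0, zero_add]
  have hsymm := polarForm_isSymm P
  have hsq {v w} (hv : v ∈ V) (hw : w ∈ Vᗮ) : polarForm P v v w = 0 ∧ polarForm P v w w = 0 := by
    have hpos := hsymm.apply_add_self v w
    have hneg := hsymm.apply_add_self v (-w)
    rw [polarForm_apply_self hP, hadd v hv w hw] at hpos
    rw [polarForm_apply_self hP, hadd v hv _ (Vᗮ.neg_mem hw)] at hneg
    simp only [mul_add, ← polarForm_apply_self hP, map_neg, LinearMap.neg_apply] at hpos hneg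
    constructor <;> linarith
  refine ⟨V, hV, hW, fun v hv w hw => LinearMap.ext fun x => ?_⟩
  obtain ⟨y, hy, z, hz, rfl⟩ := V.exists_add_mem_mem_orthogonal x
  have hvy := (hsq (V.add_mem hv hy) hw).1
  have hwz := (hsq hv (Vᗮ.add_mem hw hz)).2
  simp only [map_add, LinearMap.add_apply, LinearMap.zero_apply, (hsq hv hw).1, (hsq hy hw).1,
    (hsq hv hw).2, (hsq hv hz).2, hsymm.swap_left y v, hsymm.swap_right v z w,
    hsymm.swap_right v y w] at hvy hwz ⊢
  linarith

theorem polarForm_eq_pullback_iff (hP : P.IsHomogeneous 3) (hQ : Q.IsHomogeneous 3)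
    (g : EuclideanSpace ℝ (Fin n) ≃ₗ[ℝ] EuclideanSpace ℝ (Fin n)) :
    polarForm Q = (polarForm P).pullback g ↔ linAct g (polyFun Q) = polyFun P := by
  constructor
  · intro h
    funext x
    have hx := congr($h (g⁻¹ x) (g⁻¹ x) (g⁻¹ x))
    have hgx : g (g⁻¹ x) = x := g.apply_symm_apply x
    rw [TrilinForm.pullback_apply, polarForm_apply_self hQ, LinearEquiv.coe_coe, hgx,
      polarForm_apply_self hP] at hx
    exact mul_left_cancel₀ (by norm_num) hx
  · intro h
    refine polarForm_eq hQ ((polarForm_isSymm P).pullback _) fun x => ?_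
    have hgx : g⁻¹ (g x) = x := g.symm_apply_apply x
    rw [TrilinForm.pullback_apply, LinearEquiv.coe_coe, polarForm_apply_self hP, ← h, linAct, hgx]

theorem mem_polyAut_iff (hP : P.IsHomogeneous 3)
    {g : EuclideanSpace ℝ (Fin n) ≃ₗ[ℝ] EuclideanSpace ℝ (Fin n)} :
    g ∈ polyAut P ↔ (polarForm P).pullback g = polarForm P := by
  rw [eq_comm, polarForm_eq_pullback_iff hP hP]
  rfl

theorem isCriticalVector_iff (hP : P.IsHomogeneous 3) {v : EuclideanSpace ℝ (Fin n)} (hv : v ≠ 0) :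
    IsCriticalVector P v ↔ ∃ c, ∀ x, polarForm P v v x = c * ⟪v, x⟫ := by
  let b := EuclideanSpace.basisFun (Fin n) ℝ
  have hcoord (i : Fin n) : polarForm P v v (b i) = 2 * polyFun (pderiv i P) v := by
    rw [← dirDeriv_single, ← polarForm_apply_self_right hP, (polarForm_isSymm P).swap_right,
      (polarForm_isSymm P).swap_left, EuclideanSpace.basisFun_apply]
  have hinner (i : Fin n) : ⟪v, b i⟫ = v i := by
    rw [EuclideanSpace.basisFun_apply, EuclideanSpace.inner_single_right]
    simp
  constructor
  · intro h
    obtain ⟨j, hj⟩ : ∃ j, v j ≠ 0 := by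
      by_contra! hzero
      exact hv (PiLp.ext hzero)
    let c := 2 * polyFun (pderiv j P) v / v j
    have heq : polarForm P v v = c • innerₗ _ v := b.toBasis.ext fun i => by
      rw [b.coe_toBasis, hcoord, LinearMap.smul_apply, innerₗ_apply_apply, hinner, smul_eq_mul,
        div_mul_eq_mul_div, eq_div_iff hj]
      linarith [h i j]
    exact ⟨c, fun x => by rw [heq]; rfl⟩
  · rintro ⟨c, hc⟩ i j
    have hi := (hcoord i).symm.trans (hc _)
    have hj := (hcoord j).symm.trans (hc _)
    rw [hinner] at hi hj
    linear_combination v i / 2 * hj - v j / 2 * hi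

end PolarForms

section SimplexFrames

open scoped RealInnerProductSpace

variable {E ι : Type*} [NormedAddCommGroup E] [InnerProductSpace ℝ E] [Fintype ι]

/-- The symmetric trilinear form whose restriction to the diagonal is the sum of the cubes of the
coordinates `⟪w i, x⟫`. -/
noncomputable def simplexForm (w : ι → E) : TrilinForm E :=
  ∑ i, (innerₗ E (w i)).smulRight ((innerₗ E (w i)).smulRight (innerₗ E (w i)))

theorem simplexForm_apply (w : ι → E) (x y z : E) :
    simplexForm w x y z = ∑ i, ⟪w i, x⟫ * ⟪w i, y⟫ * ⟪w i, z⟫ := by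
  simp [simplexForm, mul_assoc]

theorem simplexForm_isSymm (w : ι → E) : (simplexForm w).IsSymm where
  swap_left x y z := by simp only [simplexForm_apply, mul_comm ⟪_, x⟫]
  swap_right x y z := by simp only [simplexForm_apply, mul_right_comm _ ⟪_, y⟫]

theorem simplexForm_apply_eq_inner (w : ι → E) (x y z : E) :
    simplexForm w x y z = ⟪∑ i, (⟪w i, x⟫ * ⟪w i, y⟫) • w i, z⟫ := by
  simp only [simplexForm_apply, sum_inner, real_inner_smul_left]

variable [DecidableEq ι]

/-- The vertices of a regular simplex centred at the origin of a Euclidean space of dimension one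
less than their number, normalized as the orthogonal projections of the standard basis of `ℝ^ι` to
the hyperplane of vectors with coordinate sum zero. -/
structure IsSimplexFrame (w : ι → E) : Prop where
  inner_eq (i j : ι) : ⟪w i, w j⟫ = (if i = j then 1 else 0) - (Fintype.card ι : ℝ)⁻¹
  sum_inner_smul (x : E) : ∑ i, ⟪w i, x⟫ • w i = x

namespace IsSimplexFrame

variable {w : ι → E}

theorem map {F : Type*} [NormedAddCommGroup F] [InnerProductSpace ℝ F] (hw : IsSimplexFrame w)
    (g : E ≃ₗᵢ[ℝ] F) : IsSimplexFrame (g ∘ w) where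
  inner_eq i j := by simp [hw.inner_eq]
  sum_inner_smul x := by
    obtain ⟨x, rfl⟩ := g.surjective x
    simp [← map_smul, ← map_sum, hw.sum_inner_smul]

theorem finiteDimensional (hw : IsSimplexFrame w) : FiniteDimensional ℝ E :=
  Module.Finite.of_surjective (Fintype.linearCombination ℝ w) fun x =>
    ⟨fun i => ⟪w i, x⟫, by simp [Fintype.linearCombination_apply, hw.sum_inner_smul]⟩

theorem sum_inner_mul_inner (hw : IsSimplexFrame w) (x y : E) :
    ∑ i, ⟪w i, x⟫ * ⟪w i, y⟫ = ⟪x, y⟫ := by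
  conv_rhs => rw [← hw.sum_inner_smul x]
  simp only [sum_inner, real_inner_smul_left]

theorem ext_inner (hw : IsSimplexFrame w) {x y : E} (h : ∀ i, ⟪w i, x⟫ = ⟪w i, y⟫) : x = y := by
  rw [← hw.sum_inner_smul x, ← hw.sum_inner_smul y]
  simp only [h]

theorem inner_sum_smul (hw : IsSimplexFrame w) (a : ι → ℝ) (i : ι) :
    ⟪w i, ∑ j, a j • w j⟫ = a i - (∑ j, a j) / Fintype.card ι := by
  simp [inner_sum, real_inner_smul_right, hw.inner_eq, mul_sub, Finset.sum_sub_distrib,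
    ← Finset.sum_mul, div_eq_mul_inv]

theorem sum_eq_zero (hw : IsSimplexFrame w) : ∑ i, w i = 0 := by
  refine hw.ext_inner fun i => ?_
  have : Nonempty ι := ⟨i⟩
  have hsum := hw.inner_sum_smul 1 i
  simpa using hsum

theorem sum_inner_eq_zero (hw : IsSimplexFrame w) (x : E) : ∑ i, ⟪w i, x⟫ = 0 := by
  rw [← sum_inner, hw.sum_eq_zero, inner_zero_left]

theorem sum_smul_eq_zero_iff (hw : IsSimplexFrame w) {a : ι → ℝ} :
    ∑ i, a i • w i = 0 ↔ ∀ i j, a i = a j := by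
  constructor
  · intro h i j
    have hi := hw.inner_sum_smul a i
    have hj := hw.inner_sum_smul a j
    rw [h, inner_zero_right] at hi hj
    linarith
  · intro h
    rcases isEmpty_or_nonempty ι with _ | ⟨⟨i⟩⟩
    · simp
    · simp only [h _ i, ← Finset.smul_sum, hw.sum_eq_zero, smul_zero]

theorem sum_smul_eq_sum_smul_iff (hw : IsSimplexFrame w) {a b : ι → ℝ} :
    ∑ i, a i • w i = ∑ i, b i • w i ↔ ∀ i j, a i - b i = a j - b j := by
  rw [← sub_eq_zero, ← Finset.sum_sub_distrib, ← hw.sum_smul_eq_zero_iff]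
  simp only [sub_smul]

theorem simplexForm_eq_zero_iff (hw : IsSimplexFrame w) {x y : E} :
    simplexForm w x y = 0 ↔ ∀ i j, ⟪w i, x⟫ * ⟪w i, y⟫ = ⟪w j, x⟫ * ⟪w j, y⟫ := by
  rw [← hw.sum_smul_eq_zero_iff (a := fun i => ⟪w i, x⟫ * ⟪w i, y⟫), LinearMap.ext_iff]
  simp only [simplexForm_apply_eq_inner, LinearMap.zero_apply]
  exact ⟨fun h => inner_self_eq_zero.1 (h _), fun h z => by rw [h, inner_zero_left]⟩

theorem sum_sum_mul_inner_sq (hw : IsSimplexFrame w) (x y : E) :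
    ∑ i, ∑ j, ⟪w i, x⟫ * ⟪w j, y⟫ * ⟪w i, w j⟫ ^ 2 = (1 - 2 / Fintype.card ι) * ⟪x, y⟫ := by
  have hsq (i j : ι) : ⟪w i, w j⟫ ^ 2 =
      (if i = j then 1 - 2 / (Fintype.card ι : ℝ) else 0) + (Fintype.card ι : ℝ)⁻¹ ^ 2 := by
    rw [hw.inner_eq]
    split_ifs <;> ring
  simp only [hsq, mul_add, mul_ite, mul_zero, Finset.sum_add_distrib, Finset.sum_ite_eq,
    Finset.mem_univ, if_true, ← Finset.sum_mul, ← Finset.mul_sum, hw.sum_inner_mul_inner,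
    hw.sum_inner_eq_zero, zero_mul, mul_zero, add_zero]
  exact mul_comm _ _

theorem solvesSystem (hw : IsSimplexFrame w) (c : ℝ) :
    (c • simplexForm w).SolvesSystem (c ^ 2 * (1 - 2 / Fintype.card ι)) := by
  have := hw.finiteDimensional
  let b := stdOrthonormalBasis ℝ E
  have hparseval (x y : E) : ∑ k, ⟪x, b k⟫ * ⟪y, b k⟫ = ⟪x, y⟫ := by
    simpa only [real_inner_comm y] using b.sum_inner_mul_inner x y
  refine .of_orthonormalBasis b ((simplexForm_isSymm w).smul c) (fun x => ?_) (fun x y => ?_)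
  · simp only [LinearMap.smul_apply, smul_eq_mul, ← Finset.mul_sum, simplexForm_apply]
    rw [Finset.sum_comm]
    simp only [mul_assoc, ← Finset.mul_sum, hparseval, hw.inner_eq, if_true, ← Finset.sum_mul,
      hw.sum_inner_eq_zero, zero_mul, mul_zero]
  · have hsum (u : E) : ∑ l, simplexForm w x u (b l) * simplexForm w y u (b l) =
        ∑ i, ∑ j, ⟪w i, x⟫ * ⟪w j, y⟫ * ⟪w i, w j⟫ * (⟪w i, u⟫ * ⟪w j, u⟫) := by
      simp only [simplexForm_apply_eq_inner, hparseval]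
      simp only [sum_inner, inner_sum, real_inner_smul_left, real_inner_smul_right]
      rw [Finset.sum_comm]
      exact Finset.sum_congr rfl fun i _ => Finset.sum_congr rfl fun j _ => by ring
    rw [mul_assoc, ← hw.sum_sum_mul_inner_sq]
    simp only [LinearMap.smul_apply, smul_eq_mul, mul_mul_mul_comm c, ← Finset.mul_sum, ← sq, hsum]
    rw [Finset.sum_comm]
    refine congrArg (c ^ 2 * ·) (Finset.sum_congr rfl fun i _ => ?_)
    rw [Finset.sum_comm]
    refine Finset.sum_congr rfl fun j _ => ?_
    rw [← Finset.mul_sum, hparseval, mul_assoc, ← sq]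

theorem mul_inner_eq_zero (hw : IsSimplexFrame w) {x y : E} (h : simplexForm w x y = 0)
    (hxy : ⟪x, y⟫ = 0) (i : ι) : ⟪w i, x⟫ * ⟪w i, y⟫ = 0 := by
  have hconst := hw.simplexForm_eq_zero_iff.1 h
  have hsum := hw.sum_inner_mul_inner x y
  simp only [hxy, hconst _ i, Finset.sum_const, smul_eq_zero] at hsum
  exact hsum.resolve_left (Finset.card_ne_zero_of_mem (Finset.mem_univ i))

theorem eq_top_of_forall_mem (hw : IsSimplexFrame w) {V : Submodule ℝ E} (h : ∀ i, w i ∈ V) :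
    V = ⊤ :=
  V.eq_top_iff'.2 fun x => hw.sum_inner_smul x ▸ V.sum_mem fun i _ => V.smul_mem _ (h i)

theorem not_isDecomposable (hw : IsSimplexFrame w) {c : ℝ} (hc : c ≠ 0) :
    ¬ (c • simplexForm w).IsDecomposable := by
  have := hw.finiteDimensional
  rintro ⟨V, hV, hV', h⟩
  have hmem (i : ι) : w i ∈ V ∨ w i ∈ Vᗮ := by
    obtain ⟨v, hv, u, hu, hvu⟩ := V.exists_add_mem_mem_orthogonal (w i)
    have hzero : simplexForm w v u = 0 := (smul_eq_zero.1 (h v hv u hu)).resolve_left hc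
    have hvu_inner : ⟪v, u⟫ = 0 := hu v hv
    have huv_inner : ⟪u, v⟫ = 0 := real_inner_comm u v ▸ hvu_inner
    have hmul := hw.mul_inner_eq_zero hzero hvu_inner i
    rw [hvu, inner_add_left, inner_add_left, huv_inner, hvu_inner, add_zero, zero_add,
      mul_eq_zero, inner_self_eq_zero, inner_self_eq_zero] at hmul
    rcases hmul with rfl | rfl
    · exact .inr (by rwa [hvu, zero_add])
    · exact .inl (by rwa [hvu, add_zero])
  have hne (i j : ι) (hi : w i ∈ V) (hj : w j ∈ Vᗮ) (hij : i ≠ j) : False := by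
    have : Nonempty ι := ⟨i⟩
    have hinner := hw.inner_eq i j
    rw [hj _ hi, if_neg hij, zero_sub, eq_comm, neg_eq_zero, inv_eq_zero] at hinner
    exact Fintype.card_ne_zero (Nat.cast_eq_zero.1 hinner)
  by_cases hall : ∀ i, w i ∈ V
  · exact hV' (by rw [hw.eq_top_of_forall_mem hall, Submodule.top_orthogonal_eq_bot])
  · obtain ⟨j, hj⟩ := not_forall.1 hall
    have hj' : w j ∈ Vᗮ := (hmem j).resolve_left hj
    refine hV (V.orthogonal_eq_top_iff.1 (hw.eq_top_of_forall_mem fun i => ?_))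
    exact (hmem i).resolve_left fun hi => hne i j hi hj' (by rintro rfl; exact hj hi)

end IsSimplexFrame

end SimplexFrames

section SimplicialForm

open MvPolynomial
open scoped RealInnerProductSpace

/-- The standard simplex frame of `ℝ⁴`. Up to scaling, its members are the first five vectors
`simplicialGenerator k`. -/
noncomputable def simplexVertex : Fin 5 → EuclideanSpace ℝ (Fin 4) :=
  ![!₂[0, 0, 0, 2 * √5 / 5], !₂[1 / 2, -1 / 2, -1 / 2, -√5 / 10],
    !₂[-1 / 2, 1 / 2, -1 / 2, -√5 / 10], !₂[-1 / 2, -1 / 2, 1 / 2, -√5 / 10],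
    !₂[1 / 2, 1 / 2, 1 / 2, -√5 / 10]]

theorem inner_simplexVertex (i : Fin 5) (x : EuclideanSpace ℝ (Fin 4)) :
    ⟪simplexVertex i, x⟫ = ![2 * √5 / 5 * x 3, (x 0 - x 1 - x 2) / 2 - √5 / 10 * x 3,
      (-x 0 + x 1 - x 2) / 2 - √5 / 10 * x 3, (-x 0 - x 1 + x 2) / 2 - √5 / 10 * x 3,
      (x 0 + x 1 + x 2) / 2 - √5 / 10 * x 3] i := by
  fin_cases i <;> simp [simplexVertex, PiLp.inner_apply, Fin.sum_univ_four] <;> ring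

theorem simplexVertex_isSimplexFrame : IsSimplexFrame simplexVertex where
  inner_eq i j := by
    rw [inner_simplexVertex]
    fin_cases i <;> fin_cases j <;> simp [simplexVertex] <;> ring_nf <;> norm_num
  sum_inner_smul x := by
    ext k
    simp only [inner_simplexVertex, Fin.sum_univ_five]
    fin_cases k <;> simp [simplexVertex] <;> ring_nf
    rw [Real.sq_sqrt (by norm_num)]
    ring

theorem simplicialForm_isHomogeneous (κ : ℝ) : (simplicialForm κ).IsHomogeneous 3 := by
  have hX (i : Fin 4) : (X i : MvPolynomial (Fin 4) ℝ).IsHomogeneous 1 := isHomogeneous_X ℝ i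
  have hsq (i : Fin 4) : (X i ^ 2 : MvPolynomial (Fin 4) ℝ).IsHomogeneous 2 := (hX i).pow 2
  have hcube : (X 3 ^ 3 : MvPolynomial (Fin 4) ℝ).IsHomogeneous 3 := (hX 3).pow 3
  exact ((hcube.sub ((hX 3).mul (((hsq 0).add (hsq 1)).add (hsq 2)))).add
    ((((hX 0).mul (hX 1)).mul (hX 2)).C_mul _)).C_mul _

theorem polarForm_simplicialForm (κ : ℝ) :
    polarForm (simplicialForm κ) = (√(3 * κ) * √5 / 3) • simplexForm simplexVertex := by
  refine polarForm_eq (simplicialForm_isHomogeneous κ) ((simplexForm_isSymm _).smul _) fun x => ?_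
  have hsq : √5 ^ 2 = (5 : ℝ) := Real.sq_sqrt (by norm_num)
  simp only [LinearMap.smul_apply, smul_eq_mul, simplexForm_apply, Fin.sum_univ_five,
    inner_simplexVertex, polyFun, simplicialForm, map_mul, map_add, map_sub, map_pow, eval_X,
    eval_C, Matrix.cons_val]
  linear_combination √(3 * κ) * x 3 *
    ((√5 ^ 2 + 5) / 50 * x 3 ^ 2 - (x 0 ^ 2 + x 1 ^ 2 + x 2 ^ 2) / 10) * hsq

end SimplicialForm

section Automorphisms

open scoped RealInnerProductSpace

theorem exists_notMem_of_card_lt {ι : Type*} [Fintype ι] {s : Finset ι}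
    (h : s.card < Fintype.card ι) : ∃ i, i ∉ s :=
  (Finset.exists_mem_notMem_of_card_lt_card h).imp fun _ => And.right

theorem exists_forall_ne_eq_of_mul_sub_eq_zero {ι R : Type*} [Fintype ι] [Ring R]
    [NoZeroDivisors R] (hι : 4 ≤ Fintype.card ι) {f : ι → R}
    (h : ∀ i j k l, [i, j, k, l].Nodup → (f i - f j) * (f k - f l) = 0) :
    ∃ s u, ∀ i ≠ s, f i = u := by
  classical
  by_cases hconst : ∀ i j, f i = f j
  · obtain ⟨i⟩ : Nonempty ι := Fintype.card_pos_iff.1 (by lia)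
    exact ⟨i, f i, fun j _ => hconst j i⟩
  push Not at hconst
  obtain ⟨i, j, hij⟩ := hconst
  have hne : i ≠ j := fun h => hij (h ▸ rfl)
  simp only [mul_eq_zero, sub_eq_zero] at h
  have hrest (k l : ι) (hk : k ∉ ({i, j} : Finset ι)) (hl : l ∉ ({i, j} : Finset ι)) :
      f k = f l := by
    by_cases hkl : k = l
    · rw [hkl]
    · refine (h i j k l ?_).resolve_left hij
      clear h
      grind
  obtain ⟨k, hk⟩ := exists_notMem_of_card_lt
    (Finset.card_le_two.trans_lt (by lia) : ({i, j} : Finset ι).card < Fintype.card ι)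
  obtain ⟨l, hl⟩ := exists_notMem_of_card_lt
    (Finset.card_le_three.trans_lt (by lia) : ({i, j, k} : Finset ι).card < Fintype.card ι)
  have hnodup : [i, k, j, l].Nodup := by
    clear h hrest
    grind
  rcases h i k j l hnodup with hik | hjl
  · refine ⟨j, f k, fun x hx => ?_⟩
    by_cases hxi : x = i
    · rw [hxi, hik]
    · exact hrest x k (by simp [hx, hxi]) hk
  · have hjk : f j = f k := hjl.trans (hrest l k (by clear h hrest; grind) hk)
    refine ⟨i, f k, fun x hx => ?_⟩
    by_cases hxj : x = j
    · rw [hxj, hjk]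
    · exact hrest x k (by simp [hx, hxj]) hk

variable {E ι : Type*} [NormedAddCommGroup E] [InnerProductSpace ℝ E] [Fintype ι] [DecidableEq ι]

namespace IsSimplexFrame

variable {w : ι → E}

theorem inner_sub (hw : IsSimplexFrame w) (a i j : ι) :
    ⟪w a, w i - w j⟫ = (if a = i then 1 else 0) - if a = j then 1 else 0 := by
  rw [inner_sub_right, hw.inner_eq, hw.inner_eq, sub_sub_sub_cancel_right]

theorem injective (hw : IsSimplexFrame w) : Function.Injective w := fun i j hij => by
  have hinner := hw.inner_sub i i j
  rw [hij, sub_self, inner_zero_right, if_pos rfl] at hinner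
  by_contra hne
  simp [hne] at hinner

/-- The linear map permuting the members of a simplex frame by `σ`. -/
noncomputable def permMap (w : ι → E) (σ : Equiv.Perm ι) : E →ₗ[ℝ] E :=
  ∑ i, (innerₗ E (w i)).smulRight (w (σ i))

theorem inner_permMap (hw : IsSimplexFrame w) (σ : Equiv.Perm ι) (i : ι) (x : E) :
    ⟪w i, permMap w σ x⟫ = ⟪w (σ⁻¹ i), x⟫ := by
  have hsum : permMap w σ x = ∑ j, ⟪w (σ⁻¹ j), x⟫ • w j := by
    rw [← Equiv.sum_comp σ]
    simp [permMap]
  rw [hsum, hw.inner_sum_smul, Equiv.sum_comp σ⁻¹ fun j => ⟪w j, x⟫, hw.sum_inner_eq_zero, zero_div,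
    sub_zero]

theorem permMap_mul (hw : IsSimplexFrame w) (σ τ : Equiv.Perm ι) (x : E) :
    permMap w (σ * τ) x = permMap w σ (permMap w τ x) :=
  hw.ext_inner fun i => by simp only [hw.inner_permMap, mul_inv_rev, Equiv.Perm.mul_apply]

theorem permMap_one (hw : IsSimplexFrame w) (x : E) : permMap w 1 x = x :=
  hw.ext_inner fun i => by rw [hw.inner_permMap, inv_one, Equiv.Perm.one_apply]

/-- The action of the permutations of the vertices of a regular simplex by linear automorphisms. -/
noncomputable def permHom (hw : IsSimplexFrame w) : Equiv.Perm ι →* (E ≃ₗ[ℝ] E) where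
  toFun σ := .ofLinearMap (permMap w σ) (permMap w σ⁻¹)
    (LinearMap.ext fun x => by simp [← hw.permMap_mul, hw.permMap_one])
    (LinearMap.ext fun x => by simp [← hw.permMap_mul, hw.permMap_one])
  map_one' := LinearEquiv.ext hw.permMap_one
  map_mul' σ τ := LinearEquiv.ext (hw.permMap_mul σ τ)

theorem inner_permHom (hw : IsSimplexFrame w) (σ : Equiv.Perm ι) (i : ι) (x : E) :
    ⟪w i, hw.permHom σ x⟫ = ⟪w (σ⁻¹ i), x⟫ :=
  hw.inner_permMap σ i x

theorem permHom_injective (hw : IsSimplexFrame w) : Function.Injective hw.permHom := by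
  refine (injective_iff_map_eq_one _).2 fun σ hσ => inv_eq_one.1 (Equiv.ext fun i => ?_)
  refine hw.injective (ext_inner_right ℝ fun x => ?_)
  rw [← hw.inner_permHom, hσ]
  rfl

theorem norm_permHom (hw : IsSimplexFrame w) (σ : Equiv.Perm ι) (x : E) :
    ‖hw.permHom σ x‖ = ‖x‖ := by
  have hsq : ‖hw.permHom σ x‖ ^ 2 = ‖x‖ ^ 2 := by
    rw [← real_inner_self_eq_norm_sq, ← real_inner_self_eq_norm_sq, ← hw.sum_inner_mul_inner,
      ← hw.sum_inner_mul_inner]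
    simp only [hw.inner_permHom]
    exact Equiv.sum_comp σ⁻¹ fun i => ⟪w i, x⟫ * ⟪w i, x⟫
  exact (sq_eq_sq₀ (norm_nonneg _) (norm_nonneg _)).1 hsq

theorem pullback_permHom (hw : IsSimplexFrame w) (σ : Equiv.Perm ι) :
    (simplexForm w).pullback (hw.permHom σ) = simplexForm w := by
  refine LinearMap.ext fun x => LinearMap.ext₂ fun y z => ?_
  simp only [TrilinForm.pullback_apply, simplexForm_apply, LinearEquiv.coe_coe, hw.inner_permHom]
  exact Equiv.sum_comp σ⁻¹ fun i => ⟪w i, x⟫ * ⟪w i, y⟫ * ⟪w i, z⟫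

section Pullback

variable {g : E ≃ₗ[ℝ] E}

theorem mul_inner_map_eq (hw : IsSimplexFrame w)
    (hg : (simplexForm w).pullback g = simplexForm w) {x y : E}
    (hxy : ∀ i, ⟪w i, x⟫ * ⟪w i, y⟫ = 0) (i j : ι) :
    ⟪w i, g x⟫ * ⟪w i, g y⟫ = ⟪w j, g x⟫ * ⟪w j, g y⟫ := by
  refine hw.simplexForm_eq_zero_iff.1 (LinearMap.ext fun z => ?_) i j
  obtain ⟨z, rfl⟩ := g.surjective z
  have hz := congr($hg x y z)
  rw [TrilinForm.pullback_apply] at hz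
  exact hz.trans (congr($(hw.simplexForm_eq_zero_iff.2 fun i j => by rw [hxy, hxy]) z))

theorem mul_inner_map_sub_eq_zero (hw : IsSimplexFrame w)
    (hg : (simplexForm w).pullback g = simplexForm w) {i j k l m : ι} (h : [i, j, k, l, m].Nodup)
    (a : ι) : ⟪w a, g (w i - w j)⟫ * ⟪w a, g (w k - w l)⟫ = 0 := by
  have hconst {n : ι} (hn : [i, j, k, n].Nodup) := hw.mul_inner_map_eq hg
    (x := w i - w j) (y := w k - w n) fun b => by
      rw [hw.inner_sub, hw.inner_sub]
      grind
  have hl := hconst (n := l) (by grind) a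
  have hm := hconst (n := m) (by grind) a
  set c := ⟪w a, g (w i - w j)⟫ * ⟪w a, g (w k - w l)⟫
  set d := ⟪w a, g (w i - w j)⟫ * ⟪w a, g (w k - w m)⟫
  by_contra hc
  have hdep : d • (w k - w l) = c • (w k - w m) :=
    g.injective (hw.ext_inner fun b => by
      have hne : ⟪w b, g (w i - w j)⟫ ≠ 0 := left_ne_zero_of_mul (hl b ▸ hc)
      rw [map_smul, map_smul, real_inner_smul_right, real_inner_smul_right]
      exact mul_left_cancel₀ hne (by linear_combination c * hm b - d * hl b))
  have hinner := congr(⟪w m, $hdep⟫)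
  rw [real_inner_smul_right, real_inner_smul_right, hw.inner_sub, hw.inner_sub] at hinner
  grind

theorem exists_inner_map_eq_mul (hw : IsSimplexFrame w) (hι : 5 ≤ Fintype.card ι)
    (hg : (simplexForm w).pullback g = simplexForm w) (a : ι) :
    ∃ s t, ∀ x, ⟪w a, g x⟫ = t * ⟪w s, x⟫ := by
  obtain ⟨s, u, hs⟩ := exists_forall_ne_eq_of_mul_sub_eq_zero (f := fun i => ⟪w a, g (w i)⟫)
    (Nat.le_of_succ_le hι) fun i j k l h => by
      obtain ⟨m, hm⟩ := exists_notMem_of_card_lt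
        (Finset.card_le_four.trans_lt hι : ({i, j, k, l} : Finset ι).card < _)
      have hzero := hw.mul_inner_map_sub_eq_zero hg (m := m) (i := i) (j := j) (k := k) (l := l)
        (by grind) a
      simpa only [map_sub, inner_sub_right] using hzero
  refine ⟨s, ⟪w a, g (w s)⟫ - u, fun x => ?_⟩
  have hsum : ∑ i, ⟪w i, x⟫ * (⟪w a, g (w i)⟫ - u) = ⟪w s, x⟫ * (⟪w a, g (w s)⟫ - u) :=
    Finset.sum_eq_single_of_mem s (Finset.mem_univ s) fun i _ hi => by
      rw [hs i hi, sub_self, mul_zero]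
  rw [mul_comm, ← hsum]
  simp only [mul_sub, Finset.sum_sub_distrib, ← Finset.sum_mul, hw.sum_inner_eq_zero, zero_mul,
    sub_zero]
  conv_lhs => rw [← hw.sum_inner_smul x]
  simp only [map_sum, map_smul, inner_sum, real_inner_smul_right]

theorem exists_perm_inner_map_eq (hw : IsSimplexFrame w) (hι : 5 ≤ Fintype.card ι)
    (hg : (simplexForm w).pullback g = simplexForm w) :
    ∃ (σ : Equiv.Perm ι) (t : ℝ), ∀ i x, ⟪w i, g x⟫ = t * ⟪w (σ i), x⟫ := by
  choose σ t h using hw.exists_inner_map_eq_mul hι hg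
  have hzero {i j : ι} (hσ : σ i = σ j) (hij : i ≠ j) : t j = 0 := by
    obtain ⟨k, hk⟩ := exists_notMem_of_card_lt
      (Finset.card_le_two.trans_lt (by lia) : ({i, j} : Finset ι).card < Fintype.card ι)
    obtain ⟨x, hx⟩ := g.surjective (w i - w k)
    have hi := h i x
    have hj := h j x
    rw [hx, hw.inner_sub] at hi hj
    grind
  have hne (i : ι) : t i ≠ 0 := fun hi => by
    obtain ⟨k, hk⟩ := exists_notMem_of_card_lt
      ((Finset.card_singleton i).trans_lt (by lia : 1 < Fintype.card ι))
    obtain ⟨x, hx⟩ := g.surjective (w i - w k)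
    have hix := h i x
    rw [hx, hw.inner_sub, hi] at hix
    grind
  have hσ : Function.Injective σ := fun i j hij => by_contra fun hij' => hne j (hzero hij hij')
  let τ : Equiv.Perm ι := .ofBijective σ (Finite.injective_iff_bijective.1 hσ)
  have hsum : ∑ i, t (τ.symm i) • w i = 0 := by
    rw [← Equiv.sum_comp τ]
    refine ext_inner_right ℝ fun x => ?_
    rw [inner_zero_left, ← hw.sum_inner_eq_zero (g x)]
    simp only [sum_inner, real_inner_smul_left, Equiv.symm_apply_apply, h]
    rfl
  have hconst (i j : ι) : t i = t j := by
    simpa using hw.sum_smul_eq_zero_iff.1 hsum (τ i) (τ j)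
  obtain ⟨j⟩ : Nonempty ι := Fintype.card_pos_iff.1 (by lia)
  exact ⟨τ, t j, fun i x => hconst i j ▸ h i x⟩

theorem exists_permHom_eq (hw : IsSimplexFrame w) (hι : 5 ≤ Fintype.card ι)
    (hg : (simplexForm w).pullback g = simplexForm w) : ∃ σ, hw.permHom σ = g := by
  obtain ⟨σ, t, hσ⟩ := hw.exists_perm_inner_map_eq hι hg
  suffices ht : t ^ 3 = 1 by
    obtain rfl : t = 1 := (Nat.odd_iff.2 rfl : Odd 3).strictMono_pow.injective (by simpa using ht)
    refine ⟨σ⁻¹, LinearEquiv.ext fun x => hw.ext_inner fun i => ?_⟩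
    rw [hw.inner_permHom, hσ, one_mul, inv_inv]
  obtain ⟨e⟩ : Nonempty (Fin 4 ↪ ι) := Function.Embedding.nonempty_of_card_le (by simp; lia)
  let x (i : Fin 4) := w (e 0) - w (e i)
  have hone : simplexForm w (x 1) (x 2) (x 3) = 1 := by
    rw [simplexForm_apply, Finset.sum_eq_single_of_mem (e 0) (Finset.mem_univ _) fun i _ hi => ?_]
    · simp [x, hw.inner_sub]
    · simp only [x, hw.inner_sub]
      grind [e.injective.eq_iff]
  have hcube : simplexForm w (g (x 1)) (g (x 2)) (g (x 3)) =
      t ^ 3 * simplexForm w (x 1) (x 2) (x 3) := by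
    rw [simplexForm_apply, simplexForm_apply, Finset.mul_sum,
      ← Equiv.sum_comp σ fun i => t ^ 3 * (⟪w i, x 1⟫ * ⟪w i, x 2⟫ * ⟪w i, x 3⟫)]
    exact Finset.sum_congr rfl fun i _ => by rw [hσ, hσ, hσ]; ring
  have hgx := congr($hg (x 1) (x 2) (x 3))
  rw [TrilinForm.pullback_apply, LinearEquiv.coe_coe, hcube, hone, mul_one] at hgx
  exact hgx

end Pullback

end IsSimplexFrame

end Automorphisms

section SimplicialPolynomials

open scoped RealInnerProductSpace

variable {n : ℕ} {ι : Type*} [Fintype ι] [DecidableEq ι] {w : ι → EuclideanSpace ℝ (Fin n)}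
  {P : MvPolynomial (Fin n) ℝ} {c : ℝ}

theorem IsSimplexFrame.not_orthogonallyDecomposable (hw : IsSimplexFrame w) (hP : P.IsHomogeneous 3)
    (hc : c ≠ 0) (hPw : polarForm P = c • simplexForm w) : ¬ OrthogonallyDecomposable P :=
  fun h => hw.not_isDecomposable hc (hPw ▸ h.isDecomposable hP)

theorem IsSimplexFrame.polyAut_eq_range_permHom (hw : IsSimplexFrame w) (hι : 5 ≤ Fintype.card ι)
    (hP : P.IsHomogeneous 3) (hc : c ≠ 0) (hPw : polarForm P = c • simplexForm w) :
    polyAut P = hw.permHom.range := by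
  ext g
  rw [mem_polyAut_iff hP, hPw, TrilinForm.pullback_smul, smul_right_inj hc, MonoidHom.mem_range]
  exact ⟨hw.exists_permHom_eq hι, by rintro ⟨σ, rfl⟩; exact hw.pullback_permHom σ⟩

theorem IsSimplexFrame.norm_map_of_mem_polyAut (hw : IsSimplexFrame w) (hι : 5 ≤ Fintype.card ι)
    (hP : P.IsHomogeneous 3) (hc : c ≠ 0) (hPw : polarForm P = c • simplexForm w)
    {g : EuclideanSpace ℝ (Fin n) ≃ₗ[ℝ] EuclideanSpace ℝ (Fin n)} (hg : g ∈ polyAut P)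
    (x : EuclideanSpace ℝ (Fin n)) : ‖g x‖ = ‖x‖ := by
  rw [hw.polyAut_eq_range_permHom hι hP hc hPw] at hg
  obtain ⟨σ, rfl⟩ := MonoidHom.mem_range.1 hg
  exact hw.norm_permHom σ x

theorem IsSimplexFrame.nonempty_polyAut_mulEquiv_perm (hw : IsSimplexFrame w)
    (hι : 5 ≤ Fintype.card ι) (hP : P.IsHomogeneous 3) (hc : c ≠ 0)
    (hPw : polarForm P = c • simplexForm w) : Nonempty (polyAut P ≃* Equiv.Perm ι) :=
  ⟨(MulEquiv.subgroupCongr (hw.polyAut_eq_range_permHom hι hP hc hPw)).trans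
    (MonoidHom.ofInjective hw.permHom_injective).symm⟩

variable {κ : ℝ}

theorem exists_isSimplexFrame_polarForm_eq {P : MvPolynomial (Fin 4) ℝ} (hP : P.IsHomogeneous 3)
    (h : OrthogonallyEquivalent P (simplicialForm κ)) :
    ∃ w : Fin 5 → EuclideanSpace ℝ (Fin 4), IsSimplexFrame w ∧
      polarForm P = (√(3 * κ) * √5 / 3) • simplexForm w := by
  obtain ⟨g, hg⟩ := h
  refine ⟨g ∘ simplexVertex, simplexVertex_isSimplexFrame.map g, ?_⟩
  have hpull := (polarForm_eq_pullback_iff hP (simplicialForm_isHomogeneous κ) _).2 hg.symm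
  refine LinearMap.ext fun x => LinearMap.ext₂ fun y z => ?_
  obtain ⟨x, rfl⟩ := g.surjective x
  obtain ⟨y, rfl⟩ := g.surjective y
  obtain ⟨z, rfl⟩ := g.surjective z
  refine congr($hpull x y z).symm.trans ?_
  simp only [polarForm_simplicialForm, LinearMap.smul_apply, simplexForm_apply, Function.comp_apply,
    LinearIsometryEquiv.inner_map_map]

theorem solvesSystem_of_orthogonallyEquivalent (hκ : 0 < κ) {P : MvPolynomial (Fin 4) ℝ}
    (hP : P.IsHomogeneous 3) (h : OrthogonallyEquivalent P (simplicialForm κ)) :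
    ¬ OrthogonallyDecomposable P ∧ SolvesSystem κ P := by
  obtain ⟨w, hw, hPw⟩ := exists_isSimplexFrame_polarForm_eq hP h
  refine ⟨hw.not_orthogonallyDecomposable hP (by positivity) hPw, ?_⟩
  rw [solvesSystem_iff_polarForm hP, hPw]
  convert hw.solvesSystem _
  rw [div_pow, mul_pow, Real.sq_sqrt (by positivity), Real.sq_sqrt (by norm_num), Fintype.card_fin]
  norm_num
  ring

theorem OrthogonallyEquivalent.refl (P : MvPolynomial (Fin n) ℝ) : OrthogonallyEquivalent P P :=
  ⟨.refl ℝ _, rfl⟩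

theorem solvesSystem_iff_orthogonallyEquivalent (hκ : 0 < κ) {P : MvPolynomial (Fin 4) ℝ}
    (hP : P.IsHomogeneous 3) :
    ¬ OrthogonallyDecomposable P ∧ SolvesSystem κ P ↔
      OrthogonallyEquivalent P (simplicialForm κ) := by
  have hS := simplicialForm_isHomogeneous κ
  obtain ⟨hSdec, hSκ⟩ := solvesSystem_of_orthogonallyEquivalent hκ hS (.refl _)
  exact ⟨fun h => orthogonallyEquivalent_of_solvesSystem hκ hP hS h.1 hSdec h.2 hSκ,
    solvesSystem_of_orthogonallyEquivalent hκ hP⟩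

end SimplicialPolynomials

section CriticalLines

open scoped RealInnerProductSpace

variable {E ι : Type*} [NormedAddCommGroup E] [InnerProductSpace ℝ E] [Fintype ι] [DecidableEq ι]

/-- The sum of the vertices of the face `s` of the simplex with vertices `w`: a multiple of its
barycentre. -/
def vertexSum (w : ι → E) (s : Finset ι) : E := ∑ i ∈ s, w i

theorem vertexSum_eq_sum_smul (w : ι → E) (s : Finset ι) :
    vertexSum w s = ∑ i, (if i ∈ s then 1 else 0 : ℝ) • w i := by
  simp [vertexSum]

namespace IsSimplexFrame

variable {w : ι → E} {s t : Finset ι}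

theorem inner_vertexSum (hw : IsSimplexFrame w) (i : ι) (s : Finset ι) :
    ⟪w i, vertexSum w s⟫ = (if i ∈ s then 1 else 0) - s.card / Fintype.card ι := by
  rw [vertexSum_eq_sum_smul, hw.inner_sum_smul]
  simp

theorem vertexSum_compl (hw : IsSimplexFrame w) (s : Finset ι) :
    vertexSum w sᶜ = -vertexSum w s :=
  eq_neg_of_add_eq_zero_left ((Finset.sum_compl_add_sum s w).trans hw.sum_eq_zero)

theorem inner_vertexSum_vertexSum (hw : IsSimplexFrame w) (s t : Finset ι) :
    ⟪vertexSum w s, vertexSum w t⟫ = (s ∩ t).card - s.card * t.card / Fintype.card ι := by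
  rw [vertexSum, sum_inner]
  simp only [hw.inner_vertexSum, Finset.sum_sub_distrib, Finset.sum_boole, Finset.sum_const,
    nsmul_eq_mul, Finset.filter_mem_eq_inter, mul_div_assoc]

theorem inner_vertexSum_ne_zero (hw : IsSimplexFrame w) (hι : (Fintype.card ι).Prime)
    (hs : s.Nonempty) (hs' : s ≠ Finset.univ) (ht : t.Nonempty) (ht' : t ≠ Finset.univ) :
    ⟪vertexSum w s, vertexSum w t⟫ ≠ 0 := by
  intro h
  rw [hw.inner_vertexSum_vertexSum, sub_eq_zero, eq_div_iff (by exact_mod_cast hι.ne_zero)] at h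
  have hdvd : Fintype.card ι ∣ s.card * t.card := Dvd.intro_left (s ∩ t).card (mod_cast h)
  have hnot {r : Finset ι} (hr : r.Nonempty) (hr' : r ≠ Finset.univ) :
      ¬ Fintype.card ι ∣ r.card :=
    Nat.not_dvd_of_pos_of_lt hr.card_pos ((Finset.card_lt_iff_ne_univ r).2 hr')
  exact (hι.dvd_mul.1 hdvd).elim (hnot hs hs') (hnot ht ht')

theorem vertexSum_eq_zero_iff (hw : IsSimplexFrame w) :
    vertexSum w s = 0 ↔ s = ∅ ∨ s = Finset.univ := by
  constructor
  · intro h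
    rw [vertexSum_eq_sum_smul, hw.sum_smul_eq_zero_iff] at h
    by_contra! hs
    obtain ⟨i, hi⟩ := hs.1
    obtain ⟨j, hj⟩ := not_forall.1 fun hall => hs.2 (Finset.eq_univ_iff_forall.2 hall)
    simpa [hi, hj] using h i j
  · rintro (rfl | rfl)
    · exact Finset.sum_empty
    · exact hw.sum_eq_zero

theorem eq_or_eq_compl_of_span_vertexSum_eq (hw : IsSimplexFrame w) (hs : s.Nonempty)
    (hs' : s ≠ Finset.univ)
    (h : Submodule.span ℝ {vertexSum w s} = Submodule.span ℝ {vertexSum w t}) :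
    s = t ∨ s = tᶜ := by
  obtain ⟨r, hr⟩ := Submodule.mem_span_singleton.1
    (h ▸ Submodule.mem_span_singleton_self (vertexSum w s))
  rw [vertexSum_eq_sum_smul, vertexSum_eq_sum_smul, Finset.smul_sum] at hr
  simp only [smul_smul] at hr
  have hconst := hw.sum_smul_eq_sum_smul_iff.1 hr
  obtain ⟨i, hi⟩ := hs
  obtain ⟨j, hj⟩ := not_forall.1 fun hall => hs' (Finset.eq_univ_iff_forall.2 hall)
  have hij := hconst i j
  by_cases hit : i ∈ t
  · refine .inl (Finset.ext fun k => ?_)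
    have hik := hconst i k
    grind
  · refine .inr (Finset.ext fun k => ?_)
    have hik := hconst i k
    rw [Finset.mem_compl]
    grind

theorem simplexForm_apply_self_eq_mul_inner_iff (hw : IsSimplexFrame w) {v : E} {μ : ℝ} :
    (∀ x, simplexForm w v v x = μ * ⟪v, x⟫) ↔
      ∀ i j, ⟪w i, v⟫ ^ 2 - μ * ⟪w i, v⟫ = ⟪w j, v⟫ ^ 2 - μ * ⟪w j, v⟫ := by
  have hiff := hw.sum_smul_eq_sum_smul_iff (a := fun i => ⟪w i, v⟫ ^ 2)
    (b := fun i => μ * ⟪w i, v⟫)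
  simp only [mul_smul μ, ← Finset.smul_sum, hw.sum_inner_smul] at hiff
  rw [← hiff]
  simp only [simplexForm_apply_eq_inner, ← real_inner_smul_left, ← sq]
  exact ⟨ext_inner_right ℝ, fun h x => by rw [h]⟩

theorem exists_eq_smul_vertexSum_iff (hw : IsSimplexFrame w) {v : E} :
    (∃ s, ∃ t : ℝ, v = t • vertexSum w s) ↔ ∃ μ : ℝ, ∀ x, simplexForm w v v x = μ * ⟪v, x⟫ := by
  simp only [hw.simplexForm_apply_self_eq_mul_inner_iff]
  constructor
  · rintro ⟨s, t, rfl⟩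
    refine ⟨t * (1 - 2 * (s.card / Fintype.card ι)), fun i j => ?_⟩
    simp only [real_inner_smul_right, hw.inner_vertexSum]
    split_ifs <;> ring
  · rintro ⟨μ, h⟩
    rcases isEmpty_or_nonempty ι with _ | ⟨⟨i⟩⟩
    · exact ⟨∅, 0, by rw [← hw.sum_inner_smul v]; simp⟩
    -- The values `⟪w j, v⟫` are roots of one monic quadratic polynomial, whose roots have sum `μ`.
    have hval (j : ι) : ⟪w j, v⟫ - (2 * ⟪w i, v⟫ - μ) * (if ⟪w j, v⟫ = ⟪w i, v⟫ then 1 else 0) =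
        μ - ⟪w i, v⟫ := by
      split_ifs with hj
      · rw [hj]
        ring
      · exact mul_left_cancel₀ (sub_ne_zero.2 hj) (by linear_combination h j i)
    refine ⟨Finset.univ.filter fun j => ⟪w j, v⟫ = ⟪w i, v⟫, 2 * ⟪w i, v⟫ - μ, ?_⟩
    conv_lhs => rw [← hw.sum_inner_smul v]
    simp only [vertexSum_eq_sum_smul, Finset.smul_sum, smul_smul, Finset.mem_filter_univ]
    exact hw.sum_smul_eq_sum_smul_iff.2 fun j k => by rw [hval, hval]

end IsSimplexFrame

section Polynomials

variable {n : ℕ} {w : ι → EuclideanSpace ℝ (Fin n)} {P : MvPolynomial (Fin n) ℝ} {c : ℝ}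

theorem IsSimplexFrame.isCriticalVector_iff (hw : IsSimplexFrame w) (hP : P.IsHomogeneous 3)
    (hc : c ≠ 0) (hPw : polarForm P = c • simplexForm w) {v : EuclideanSpace ℝ (Fin n)}
    (hv : v ≠ 0) : IsCriticalVector P v ↔ ∃ s, ∃ t : ℝ, v = t • vertexSum w s := by
  rw [_root_.isCriticalVector_iff hP hv, hw.exists_eq_smul_vertexSum_iff, hPw]
  simp only [LinearMap.smul_apply, smul_eq_mul]
  constructor
  · rintro ⟨d, hd⟩
    exact ⟨d / c, fun x => by rw [div_mul_eq_mul_div, eq_div_iff hc, mul_comm, hd]⟩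
  · rintro ⟨μ, hμ⟩
    exact ⟨c * μ, fun x => by rw [hμ, mul_assoc]⟩

theorem IsSimplexFrame.criticalLines_eq (hw : IsSimplexFrame w) (hP : P.IsHomogeneous 3)
    (hc : c ≠ 0) (hPw : polarForm P = c • simplexForm w) :
    criticalLines P = (fun s => Submodule.span ℝ {vertexSum w s}) ''
      {s | s.Nonempty ∧ s ≠ Finset.univ} := by
  ext ℓ
  constructor
  · rintro ⟨v, hv, hcrit, rfl⟩
    obtain ⟨s, t, rfl⟩ := (hw.isCriticalVector_iff hP hc hPw hv).1 hcrit
    obtain ⟨ht, hs⟩ := smul_ne_zero_iff.1 hv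
    rw [Ne, hw.vertexSum_eq_zero_iff, not_or, ← Ne, ← Finset.nonempty_iff_ne_empty] at hs
    exact ⟨s, hs, (Submodule.span_singleton_smul_eq ht.isUnit _).symm⟩
  · rintro ⟨s, ⟨hs, hs'⟩, rfl⟩
    have hne : vertexSum w s ≠ 0 := fun h =>
      (hw.vertexSum_eq_zero_iff.1 h).elim hs.ne_empty hs'
    exact ⟨_, hne, (hw.isCriticalVector_iff hP hc hPw hne).2 ⟨s, 1, (one_smul ..).symm⟩, rfl⟩

theorem IsSimplexFrame.not_isOrtho_of_mem_criticalLines (hw : IsSimplexFrame w)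
    (hι : (Fintype.card ι).Prime) (hP : P.IsHomogeneous 3) (hc : c ≠ 0)
    (hPw : polarForm P = c • simplexForm w) {ℓ ℓ' : Submodule ℝ (EuclideanSpace ℝ (Fin n))}
    (hℓ : ℓ ∈ criticalLines P) (hℓ' : ℓ' ∈ criticalLines P) : ¬ ℓ.IsOrtho ℓ' := by
  rw [hw.criticalLines_eq hP hc hPw] at hℓ hℓ'
  obtain ⟨s, ⟨hs, hs'⟩, rfl⟩ := hℓ
  obtain ⟨t, ⟨ht, ht'⟩, rfl⟩ := hℓ'
  exact fun h => hw.inner_vertexSum_ne_zero hι hs hs' ht ht'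
    (h.inner_eq (Submodule.mem_span_singleton_self _) (Submodule.mem_span_singleton_self _))

end Polynomials

section SimplicialForm

/-- A choice of one face from each pair of complementary faces of the simplex with vertices
`simplexVertex`, listed so that its barycentre lies on the line of `simplicialGenerator k`. -/
def simplicialFace : Fin 15 → Finset (Fin 5) :=
  ![{0}, {1}, {2}, {3}, {4}, {0, 1}, {0, 2}, {0, 3}, {0, 4}, {2, 3}, {1, 4}, {1, 3}, {2, 4},
    {1, 2}, {3, 4}]

theorem simplicialFace_nonempty_and_ne_univ (k : Fin 15) :
    (simplicialFace k).Nonempty ∧ simplicialFace k ≠ Finset.univ := by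
  decide +revert

theorem exists_eq_simplicialFace_or_eq_compl {s : Finset (Fin 5)} (hs : s.Nonempty)
    (hs' : s ≠ Finset.univ) : ∃ k, s = simplicialFace k ∨ s = (simplicialFace k)ᶜ := by
  decide +revert

theorem eq_of_simplicialFace_eq_or_eq_compl {k l : Fin 15}
    (h : simplicialFace k = simplicialFace l ∨ simplicialFace k = (simplicialFace l)ᶜ) : k = l := by
  decide +revert

theorem span_simplicialGenerator (k : Fin 15) : Submodule.span ℝ {simplicialGenerator k} =
    Submodule.span ℝ {vertexSum simplexVertex (simplicialFace k)} := by
  let r : ℝ := if k = 0 then √5 / 2 else if k < 9 then 2 * √5 else -√5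
  have hr : r ≠ 0 := by
    have : √5 ≠ 0 := by positivity
    unfold r
    split_ifs <;> simp
  suffices h : simplicialGenerator k = r • vertexSum simplexVertex (simplicialFace k) by
    rw [h, Submodule.span_singleton_smul_eq hr.isUnit]
  unfold r
  ext i
  fin_cases k <;> fin_cases i <;>
    simp [simplicialGenerator, simplicialFace, simplexVertex, vertexSum] <;> ring_nf <;> norm_num

theorem span_simplicialGenerator_injective :
    Function.Injective fun k => Submodule.span ℝ {simplicialGenerator k} := fun k l hkl => by
  simp only [span_simplicialGenerator] at hkl
  obtain ⟨hk, hk'⟩ := simplicialFace_nonempty_and_ne_univ k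
  exact eq_of_simplicialFace_eq_or_eq_compl
    (simplexVertex_isSimplexFrame.eq_or_eq_compl_of_span_vertexSum_eq hk hk' hkl)

theorem criticalLines_simplicialForm {κ : ℝ} (hκ : 0 < κ) :
    criticalLines (simplicialForm κ) =
      Set.range fun k => Submodule.span ℝ {simplicialGenerator k} := by
  rw [simplexVertex_isSimplexFrame.criticalLines_eq (simplicialForm_isHomogeneous κ) (by positivity)
    (polarForm_simplicialForm κ)]
  simp only [span_simplicialGenerator]
  refine Set.Subset.antisymm ?_ ?_
  · rintro _ ⟨s, ⟨hs, hs'⟩, rfl⟩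
    obtain ⟨k, rfl | rfl⟩ := exists_eq_simplicialFace_or_eq_compl hs hs'
    · exact ⟨k, rfl⟩
    · refine ⟨k, ?_⟩
      dsimp only
      rw [simplexVertex_isSimplexFrame.vertexSum_compl, ← Set.neg_singleton, Submodule.span_neg]
  · rintro _ ⟨k, rfl⟩
    exact ⟨_, simplicialFace_nonempty_and_ne_univ k, rfl⟩

theorem ncard_criticalLines_simplicialForm {κ : ℝ} (hκ : 0 < κ) :
    (criticalLines (simplicialForm κ)).ncard = 15 := by
  rw [criticalLines_simplicialForm hκ, ← Nat.card_coe_set_eq,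
    Nat.card_range_of_injective span_simplicialGenerator_injective, Nat.card_fin]

theorem not_isOrtho_of_mem_criticalLines_simplicialForm {κ : ℝ} (hκ : 0 < κ)
    {ℓ ℓ' : Submodule ℝ (EuclideanSpace ℝ (Fin 4))} (hℓ : ℓ ∈ criticalLines (simplicialForm κ))
    (hℓ' : ℓ' ∈ criticalLines (simplicialForm κ)) : ¬ ℓ.IsOrtho ℓ' :=
  simplexVertex_isSimplexFrame.not_isOrtho_of_mem_criticalLines (by norm_num)
    (simplicialForm_isHomogeneous κ) (by positivity) (polarForm_simplicialForm κ) hℓ hℓ'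

end SimplicialForm

end CriticalLines

theorem mainTheorem5 (κ : ℝ) (hκ : 0 < κ) :
    (∀ P : MvPolynomial (Fin 4) ℝ, P.IsHomogeneous 3 →
      ((¬ OrthogonallyDecomposable P ∧ SolvesSystem κ P) ↔
        OrthogonallyEquivalent P (simplicialForm κ))) ∧
    (∀ P : MvPolynomial (Fin 4) ℝ, P.IsHomogeneous 3 →
      OrthogonallyEquivalent P (simplicialForm κ) →
        (∀ g ∈ polyAut P, ∀ x, ‖g x‖ = ‖x‖) ∧
        Nonempty (polyAut P ≃* Equiv.Perm (Fin 5))) ∧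
    (criticalLines (simplicialForm κ)).ncard = 15 ∧
    criticalLines (simplicialForm κ) =
      Set.range (fun k => Submodule.span ℝ {simplicialGenerator k}) ∧
    (criticalLines (simplicialForm κ)).Pairwise (fun ℓ ℓ' => ¬ ℓ.IsOrtho ℓ') := by
  refine ⟨fun P hP => solvesSystem_iff_orthogonallyEquivalent hκ hP, fun P hP hPS => ?_,
    ncard_criticalLines_simplicialForm hκ, criticalLines_simplicialForm hκ,
    fun ℓ hℓ ℓ' hℓ' _ => not_isOrtho_of_mem_criticalLines_simplicialForm hκ hℓ hℓ'⟩
  obtain ⟨w, hw, hPw⟩ := exists_isSimplexFrame_polarForm_eq hP hPS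
  have hfive : 5 ≤ Fintype.card (Fin 5) := by simp
  have hc : √(3 * κ) * √5 / 3 ≠ 0 := by positivity
  exact ⟨fun g hg => hw.norm_map_of_mem_polyAut hfive hP hc hPw hg,
    hw.nonempty_polyAut_mulEquiv_perm hfive hP hc hPw⟩
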